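/- Let $\alpha\in(0,1]$, $q>3$, and let $\Omega,\Omega_S\subset\mathbb{R}^3$ be non-empty, open, bounded, connected sets of class $C^{1,\alpha}$. Let $\mathcal{E}^q$ be the set of all $\eta\in W^{2,q}(\Omega_S;\mathbb{R}^3)$ (identified with their representatives that are continuous on $\overline{\Omega_S}$) such that $$|\eta(\Omega_S)|=\int_{\Omega_S}\det\nabla\eta\,dx,\qquad \operatorname*{ess\,inf}_{\Omega_S}\det\nabla\eta>0,\qquad \overline{\Omega_S^\eta}\subseteq\overline{\Omega},$$ where $\Omega_S^\eta:=\operatorname{int}\big(\eta(\overline{\Omega_S})\big)$; put $\Omega_F^\eta:=\operatorname{int}(\Omega\setminus\Omega_S^\eta)$. Call $\eta$ injective at $x$ if $\eta(y)\neq\eta(x)$ for all $y\in\overline{\Omega_S}\setminus\{x\}$, and let $$C_\eta:=\{x\in\partial\Omega_S:\eta(x)\in\partial\Omega\},$$ $$I_\eta:=\{x\in\partial\Omega_S\setminus C_\eta:\eta\text{ is injective at }x\},\qquad N_\eta:=\{x\in\partial\Omega_S\setminus C_\eta:\eta\text{ is not injective at }x\}.$$ Let $\partial N_\eta$ and $\operatorname{Int}(C_\eta)$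 be the boundary of $N_\eta$ and the interior of $C_\eta$ in the relative topology of $\partial\Omega_S$, and let $|A|$ denote the surface area (two-dimensional Hausdorff measure) of $A\subseteq\partial\Omega_S$. Lemma 3.1. Let $\eta\in\mathcal{E}^q$. Then: 1. If $x,y\in C_\eta$ and $\eta(x)=\eta(y)$, then $x=y$. 2. If $x,y,z\in N_\eta$ and $\eta(x)=\eta(y)=\eta(z)$, then at least one of $x=y$, $x=z$, $y=z$ holds. 3. $\partial\Omega_S^\eta=\eta(I_\eta)\cup\eta(C_\eta)\cup\eta(\partial N_\eta)$. 4. $\partial\Omega_F^\eta=\eta(\overline{I_\eta})\cup\big(\partial\Omega\setminus\eta(\operatorname{Int}(C_\eta))\big)$. 5. The fluid-structure interface equals $\eta(\overline{I_\eta})$, i.e. $\partial\Omega_S^\eta\cap\partial\Omega_F^\eta=\eta(\overline{I_\eta})$. 6. If $\eta_n\in\mathcal{E}^q$ for all $n\in\mathbb{N}$ and $\eta_n\to\eta$ in $\mathcal{E}^q$, that is, in the norm of $W^{2,q}(\Omega_S)$, then $|I_\eta|\le\liminf_{n\to\infty}|I_{\eta_n}|$. -/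

import Mathlib

open MeasureTheory Filter Topology Set
open scoped ENNReal NNReal ContDiff

namespace FSI

/-- The physical space `ℝ³` with its Euclidean structure. -/
abbrev E3 : Type := EuclideanSpace ℝ (Fin 3)

/-- `U` is of class `C^{1,α}`: near each of its boundary points, in suitable Cartesian coordinates
(an orthonormal basis `b`), `U` is the set of points lying strictly above the graph of a function
`γ : ℝ² → ℝ` that is continuously differentiable with `α`-Hölder continuous derivative. -/
def IsC1Holder (α : ℝ≥0) (U : Set E3) : Prop :=
  ∀ p ∈ frontier U, ∃ r : ℝ, 0 < r ∧ ∃ (b : OrthonormalBasis (Fin 3) ℝ E3)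
    (γ : EuclideanSpace ℝ (Fin 2) → ℝ) (K : ℝ≥0),
    ContDiff ℝ 1 γ ∧ HolderWith K α (fderiv ℝ γ) ∧
      ∀ x ∈ Metric.ball p r,
        (x ∈ U ↔ γ (!₂[b.repr x 0, b.repr x 1]) < b.repr x 2)

/-- A bounded `C^{1,α}` domain: a non-empty open, bounded, connected set of class `C^{1,α}`. -/
structure IsC1HolderDomain (α : ℝ≥0) (U : Set E3) : Prop where
  isOpen : IsOpen U
  isBounded : Bornology.IsBounded U
  isConnected : IsConnected U
  isC1Holder : IsC1Holder α U

section Sobolev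

variable {F : Type*} [NormedAddCommGroup F] [NormedSpace ℝ F]

/-- `g` is a weak (distributional) derivative of `f` in the open set `U`: both are locally
integrable in `U`, and `∫_U (∂_v φ) f = - ∫_U φ (g v)` for all smooth `φ` with compact support
in `U` and all directions `v`. -/
structure HasWeakFDeriv (U : Set E3) (f : E3 → F) (g : E3 → E3 →L[ℝ] F) : Prop where
  locallyIntegrableOn : LocallyIntegrableOn f U
  locallyIntegrableOn_deriv : LocallyIntegrableOn g U
  integral_eq : ∀ φ : E3 → ℝ, ContDiff ℝ ∞ φ → HasCompactSupport φ → tsupport φ ⊆ U → ∀ v : E3,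
    ∫ x in U, (fderiv ℝ φ x v) • f x = - ∫ x in U, φ x • g x v

open Classical in
/-- The weak derivative `∇f` of `f` in `U` (unique up to a null set; zero if there is none). -/
noncomputable def weakFDeriv (U : Set E3) (f : E3 → F) : E3 → E3 →L[ℝ] F :=
  if h : ∃ g, HasWeakFDeriv U f g then h.choose else 0

/-- Membership in the Sobolev space `W^{2,q}(U)`: the function has weak derivatives of first and
second order in `U`, and it and these derivatives are in `L^q(U)`. -/
structure MemW2 (q : ℝ) (U : Set E3) (f : E3 → F) : Prop where
  hasWeakFDeriv : ∃ g, HasWeakFDeriv U f g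
  hasWeakFDeriv_two : ∃ h, HasWeakFDeriv U (weakFDeriv U f) h
  memLp : MemLp f (ENNReal.ofReal q) (volume.restrict U)
  memLp_one : MemLp (weakFDeriv U f) (ENNReal.ofReal q) (volume.restrict U)
  memLp_two : MemLp (weakFDeriv U (weakFDeriv U f)) (ENNReal.ofReal q) (volume.restrict U)

/-- The `W^{2,q}(U)` norm `‖f‖_{L^q} + ‖∇f‖_{L^q} + ‖∇²f‖_{L^q}`. -/
noncomputable def normW2 (q : ℝ) (U : Set E3) (f : E3 → F) : ℝ≥0∞ :=
  eLpNorm f (ENNReal.ofReal q) (volume.restrict U)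
    + eLpNorm (weakFDeriv U f) (ENNReal.ofReal q) (volume.restrict U)
    + eLpNorm (weakFDeriv U (weakFDeriv U f)) (ENNReal.ofReal q) (volume.restrict U)

end Sobolev

/-- The domain `Ω_S^η = int η(closure Ω_S)` occupied by the solid. -/
def solidDomain (ΩS : Set E3) (η : E3 → E3) : Set E3 :=
  interior (η '' closure ΩS)

/-- The domain `Ω_F^η = int (Ω \ Ω_S^η)` occupied by the fluid. -/
def fluidDomain (Ω ΩS : Set E3) (η : E3 → E3) : Set E3 :=
  interior (Ω \ solidDomain ΩS η)

/-- The set `𝓔^q` of admissible deformations. A class in `W^{2,q}(Ω_S)` is represented by its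
representative that is continuous up to the boundary of `Ω_S` (this gives `η` its values on `∂Ω_S`);
the values of `η` outside the closure of `Ω_S` play no role. -/
structure IsDeformation (q : ℝ) (Ω ΩS : Set E3) (η : E3 → E3) : Prop where
  continuousOn : ContinuousOn η (closure ΩS)
  memW2 : MemW2 q ΩS η
  /-- the Ciarlet–Nečas condition `|η(Ω_S)| = ∫_{Ω_S} det ∇η` -/
  ciarletNecas : volume (η '' ΩS) = ∫⁻ x in ΩS, ENNReal.ofReal (weakFDeriv ΩS η x).det
  /-- the (essential) infimum of `det ∇η` over `Ω_S` is positive -/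
  det_pos : ∃ c : ℝ, 0 < c ∧ ∀ᵐ x ∂(volume.restrict ΩS), c ≤ (weakFDeriv ΩS η x).det
  closure_subset : closure (solidDomain ΩS η) ⊆ closure Ω

/-- Convergence `η n → η` in `𝓔^q`, that is, in the norm of `W^{2,q}(Ω_S)`. -/
def TendstoDeformation (q : ℝ) (ΩS : Set E3) (ηs : ℕ → E3 → E3) (η : E3 → E3) : Prop :=
  Tendsto (fun n => normW2 q ΩS (fun x => ηs n x - η x)) atTop (𝓝 0)

/-- `η` is injective at `x`, relative to the closure of `Ω_S`. -/
def InjectiveAt (ΩS : Set E3) (η : E3 → E3) (x : E3) : Prop :=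
  ∀ y ∈ closure ΩS \ {x}, η x ≠ η y

/-- The set `C_η` of boundary points in contact with the rigid wall. -/
def wallContact (Ω ΩS : Set E3) (η : E3 → E3) : Set E3 :=
  {x | x ∈ frontier ΩS ∧ η x ∈ frontier Ω}

/-- The set `I_η` of boundary points without contact. -/
def noContact (Ω ΩS : Set E3) (η : E3 → E3) : Set E3 :=
  {x | x ∈ frontier ΩS \ wallContact Ω ΩS η ∧ InjectiveAt ΩS η x}

/-- The set `N_η` of boundary points in self-contact, away from the wall. -/
def selfContact (Ω ΩS : Set E3) (η : E3 → E3) : Set E3 :=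
  {x | x ∈ frontier ΩS \ wallContact Ω ΩS η ∧ ¬ InjectiveAt ΩS η x}

/-- The interior of `A ⊆ S` in the relative topology of `S`. -/
def relInterior (S A : Set E3) : Set E3 :=
  ((↑) : S → E3) '' interior (((↑) : S → E3) ⁻¹' A)

/-- The boundary of `A ⊆ S` in the relative topology of `S`. -/
def relFrontier (S A : Set E3) : Set E3 :=
  ((↑) : S → E3) '' frontier (((↑) : S → E3) ⁻¹' A)

end FSI

/-!
The proof has three ingredients.

*Regularity.* A function `f` in `W^{2,q}`, `q > 3`, on a domain with `C¹` boundary is `C¹` up to the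
boundary. Averages `mollify ρ U f s x` are taken with kernels supported in a cone pointing into the
domain, so they make sense at boundary points. The derivative of the average in the scale `s` is an
average of the weak gradient (`integral_divRadial_smul`), so Hölder's inequality bounds it by a
multiple of `s ^ (-3 / q)`, which is integrable at `0`; this is Morrey's estimate
`exists_norm_mollify_sub_mollify_le`. Applied to `f` and to its weak derivative it gives a classical
derivative with uniform control (`exists_continuousOn_hasFDerivAt`), and, as nearby points of the
domain are joined by paths of comparable length, strict differentiability relative to the closure and
a local Lipschitz bound by the `W^{2,q}` norm.

*Half-spaces.* A deformation is therefore strictly differentiable on the closed domain with invertible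
derivative, and the Ciarlet–Nečas condition makes it injective in the interior
(`IsDeformation.isRegularEmbedding`). At a boundary point `x` the image contains, to first order and
uniformly near `x`, an open half-space (`IsInnerConormal`). At distinct boundary points with the same
image these half-spaces are disjoint, hence opposite; so there are never three of them. At a point of
contact with the wall they both coincide with the half-space of `Ω`, so that there is only one.

*Topology.* The interior of the image contains `η x`, for `x` in the boundary, exactly when all
boundary points near `x` are in self-contact (`IsRegularEmbedding.mem_solidDomain_iff`), and the image
fills `Ω` near `η x` when all boundary points near `x` touch the wall
(`IsRegularEmbedding.image_mem_nhdsWithin_of_wall`). As contact with the wall excludes self-contact and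
injectivity at a boundary point is an open condition, the descriptions of the two boundaries and of
the interface follow. The Lipschitz bound shows that a point without contact stays without contact
along a sequence converging in `W^{2,q}`, and the lower semicontinuity of the area is Fatou's lemma.
-/

namespace FSI

section Averages

variable {F : Type*} [NormedAddCommGroup F] [NormedSpace ℝ F]

/-! ### Averages over shifted kernels and their derivatives -/

/-- The average `∫_U s⁻³ ρ((y - x) / s) u(y) dy` of `u` over the points `y = x + s w`, `w` in the support
of `ρ`. The kernel `ρ` need not be centred at `0`: a kernel that lives in an inward cone keeps the
average at a boundary point `x` inside `U`. -/
noncomputable def mollify (ρ : E3 → ℝ) (U : Set E3) (u : E3 → F) (s : ℝ) (x : E3) : F :=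
  ∫ y in U, (s⁻¹ ^ 3 * ρ (s⁻¹ • (y - x))) • u y

lemma integrable_bdd_smul {μ : Measure E3} {u : E3 → F} (hu : Integrable u μ) {k : E3 → ℝ}
    (hk : Continuous k) {A : ℝ} (hA : ∀ y, |k y| ≤ A) : Integrable (fun y => k y • u y) μ := by
  refine (hu.norm.const_mul A).mono' (hk.aestronglyMeasurable.smul hu.1) (ae_of_all _ fun y => ?_)
  rw [norm_smul]
  exact mul_le_mul_of_nonneg_right (hA y) (norm_nonneg _)

lemma exists_bound_of_compactSupport {ρ : E3 → ℝ} (hρ : Continuous ρ) (hc : HasCompactSupport ρ) :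
    ∃ A, 0 ≤ A ∧ ∀ z, |ρ z| ≤ A := by
  obtain ⟨A, hA⟩ := hc.exists_bound_of_continuous hρ
  exact ⟨A, (norm_nonneg _).trans (hA 0), hA⟩

lemma continuous_mollify {ρ : E3 → ℝ} (hρ : Continuous ρ) (hc : HasCompactSupport ρ) {U : Set E3}
    {u : E3 → F} (hu : IntegrableOn u U) (s : ℝ) : Continuous (mollify ρ U u s) := by
  obtain ⟨A, hA0, hA⟩ := exists_bound_of_compactSupport hρ hc
  refine continuous_of_dominated (bound := fun y => (|s⁻¹ ^ 3| * A) * ‖u y‖) ?_ ?_ ?_ ?_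
  · intro x
    exact (Continuous.aestronglyMeasurable (by fun_prop)).smul hu.1
  · intro x
    refine ae_of_all _ fun y => ?_
    rw [norm_smul, norm_mul, Real.norm_eq_abs, Real.norm_eq_abs]
    gcongr
    exact hA _
  · exact hu.norm.const_mul _
  · exact ae_of_all _ fun y => by fun_prop

/-- The divergence `3 ρ(z) + Dρ(z) z` of the vector field `ρ(z) z`. -/
noncomputable def divRadial (ρ : E3 → ℝ) (z : E3) : ℝ := 3 * ρ z + fderiv ℝ ρ z z

lemma hasCompactSupport_fderiv_apply_self {ρ : E3 → ℝ} (hc : HasCompactSupport ρ) :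
    HasCompactSupport fun z => fderiv ℝ ρ z z :=
  (hc.fderiv (𝕜 := ℝ)).mono fun z hz => by
    intro h; apply hz; simp [h]

lemma continuous_divRadial {ρ : E3 → ℝ} (hρ : ContDiff ℝ ∞ ρ) : Continuous (divRadial ρ) := by
  have := hρ.continuous
  have := hρ.continuous_fderiv (by simp)
  unfold divRadial
  fun_prop

lemma exists_bound_divRadial {ρ : E3 → ℝ} (hρ : ContDiff ℝ ∞ ρ) (hc : HasCompactSupport ρ) :
    ∃ A, 0 ≤ A ∧ ∀ z, |divRadial ρ z| ≤ A := by
  refine exists_bound_of_compactSupport (continuous_divRadial hρ) ?_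
  exact (hc.mul_left (f := fun _ => 3)).add (hasCompactSupport_fderiv_apply_self hc)

/-- The scale derivative of the rescaled kernel is minus the divergence in `z` of the vector field
`s⁻³ ρ(z / s) z / s`. -/
lemma hasDerivAt_kernel {ρ : E3 → ℝ} (hρ : ContDiff ℝ ∞ ρ) {s : ℝ} (hs : s ≠ 0) (z : E3) :
    HasDerivAt (fun s : ℝ => s⁻¹ ^ 3 * ρ (s⁻¹ • z)) (-(s⁻¹ ^ 4 * divRadial ρ (s⁻¹ • z))) s := by
  have h1 : HasDerivAt (fun s : ℝ => s⁻¹) (-(s ^ 2)⁻¹) s := hasDerivAt_inv hs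
  have h2 : HasDerivAt (fun s : ℝ => s⁻¹ • z) ((-(s ^ 2)⁻¹) • z) s := h1.smul_const z
  have h3 := ((hρ.differentiable (by simp)) (s⁻¹ • z)).hasFDerivAt.comp_hasDerivAt s h2
  have h4 := (h1.pow 3).mul h3
  refine h4.congr_deriv ?_
  simp only [divRadial, map_smul, smul_eq_mul, Function.comp, Pi.pow_apply]
  field_simp
  push_cast
  field_simp
  ring

lemma hasDerivAt_mollify {ρ : E3 → ℝ} (hρ : ContDiff ℝ ∞ ρ) (hc : HasCompactSupport ρ) {U : Set E3}
    {u : E3 → F} (hu : IntegrableOn u U) {s : ℝ} (hs : 0 < s) (x : E3) :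
    HasDerivAt (fun s => mollify ρ U u s x)
      (-∫ y in U, (s⁻¹ ^ 4 * divRadial ρ (s⁻¹ • (y - x))) • u y) s := by
  obtain ⟨A, hA0, hA⟩ := exists_bound_of_compactSupport hρ.continuous hc
  obtain ⟨B, hB0, hB⟩ := exists_bound_divRadial hρ hc
  have hρc := hρ.continuous
  have hdc := continuous_divRadial hρ
  rw [← integral_neg]
  simp_rw [← neg_smul]
  refine (hasDerivAt_integral_of_dominated_loc_of_deriv_le (Ioi_mem_nhds (half_lt_self hs))
    (F := fun s y => (s⁻¹ ^ 3 * ρ (s⁻¹ • (y - x))) • u y)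
    (F' := fun s y => (-(s⁻¹ ^ 4 * divRadial ρ (s⁻¹ • (y - x)))) • u y)
    (bound := fun y => ((s / 2)⁻¹ ^ 4 * B) * ‖u y‖) ?_ ?_ ?_ ?_ ?_ ?_).2
  · exact Eventually.of_forall fun t =>
      (Continuous.aestronglyMeasurable (by fun_prop)).smul hu.1
  · refine integrable_bdd_smul hu (by fun_prop) (A := |s⁻¹ ^ 3| * A) fun y => ?_
    rw [abs_mul]; gcongr; exact hA _
  · exact (Continuous.aestronglyMeasurable (by fun_prop)).smul hu.1
  · refine ae_of_all _ fun y t ht => ?_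
    have ht0 : 0 < t := (half_pos hs).trans ht
    rw [norm_smul, norm_neg, norm_mul, Real.norm_eq_abs, Real.norm_eq_abs,
      abs_of_pos (by positivity)]
    gcongr
    · exact le_of_lt ht
    · exact hB _
  · exact hu.norm.const_mul _
  · refine ae_of_all _ fun y t ht => ?_
    have ht0 : 0 < t := (half_pos hs).trans ht
    exact (hasDerivAt_kernel hρ ht0.ne' _).smul_const _

lemma tsupport_comp_rescale_subset {ρ : E3 → ℝ} {U : Set E3} {s : ℝ} (hs : 0 < s) {x : E3}
    (hU : ∀ w ∈ tsupport ρ, x + s • w ∈ U) :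
    tsupport (fun y => ρ (s⁻¹ • (y - x))) ⊆ U := by
  intro y hy
  have h := tsupport_comp_subset_preimage ρ (f := fun y : E3 => s⁻¹ • (y - x)) (by fun_prop) hy
  have := hU _ h
  simpa [smul_smul, hs.ne'] using this

lemma hasCompactSupport_comp_rescale {ρ : E3 → ℝ} (hc : HasCompactSupport ρ) {s : ℝ} (hs : 0 < s)
    (x : E3) : HasCompactSupport (fun y => ρ (s⁻¹ • (y - x))) := by
  have : (fun y => ρ (s⁻¹ • (y - x)))
      = ρ ∘ ((Homeomorph.subRight x).trans (Homeomorph.smulOfNeZero s⁻¹ (inv_ne_zero hs.ne'))) := by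
    ext y; simp
  rw [this]
  exact hc.comp_homeomorph _

lemma integrable_clm_apply {μ : Measure E3} {G : E3 → E3 →L[ℝ] F} (hG : Integrable G μ)
    {k : E3 → E3} (hk : Continuous k) {A : ℝ} (hA : ∀ y, ‖k y‖ ≤ A) : Integrable (fun y => G y (k y)) μ := by
  refine (hG.norm.mul_const A).mono' ?_ (ae_of_all _ fun y => ?_)
  · exact (ContinuousLinearMap.apply ℝ F).flip.aestronglyMeasurable_comp₂ hG.1 hk.aestronglyMeasurable
  · exact (G y).le_of_opNorm_le_of_le le_rfl (hA y)

/-- Integration by parts against the radial field `s⁻³ ρ(w) w`, `w = (y - x) / s`: the left side is the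
derivative of `mollify ρ U u s x` in the scale `s`, which is thus an average of the weak gradient. -/
lemma integral_divRadial_smul {ρ : E3 → ℝ} (hρ : ContDiff ℝ ∞ ρ) (hc : HasCompactSupport ρ)
    {U : Set E3} {u : E3 → F} {G : E3 → E3 →L[ℝ] F} (huG : HasWeakFDeriv U u G)
    (hu : IntegrableOn u U) (hG : IntegrableOn G U)
    {s : ℝ} (hs : 0 < s) {x : E3} (hU : ∀ w ∈ tsupport ρ, x + s • w ∈ U) :
    -∫ y in U, (s⁻¹ ^ 4 * divRadial ρ (s⁻¹ • (y - x))) • u y =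
      ∫ y in U, (s⁻¹ ^ 3 * ρ (s⁻¹ • (y - x))) • G y (s⁻¹ • (y - x)) := by
  have hρc := hρ.continuous
  have hρd := hρ.continuous_fderiv (by simp)
  set e : Fin 3 → E3 := fun i => EuclideanSpace.single i (1 : ℝ) with he
  set φ : Fin 3 → E3 → ℝ := fun i y => ρ (s⁻¹ • (y - x)) * (s⁻¹ ^ 3 * (s⁻¹ • (y - x)) i) with hφ
  have hφs : ∀ i, ContDiff ℝ ∞ (φ i) := fun i => by
    have h1 : ContDiff ℝ ∞ (fun y : E3 => s⁻¹ • (y - x)) := by fun_prop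
    have h2 : ContDiff ℝ ∞ (fun y : E3 => (s⁻¹ • (y - x)) i) :=
      (contDiff_euclidean.1 h1 i)
    exact (hρ.comp h1).mul (contDiff_const.mul h2)
  have hφc : ∀ i, HasCompactSupport (φ i) := fun i =>
    (hasCompactSupport_comp_rescale hc hs x).mul_right
  have hφt : ∀ i, tsupport (φ i) ⊆ U := fun i =>
    (tsupport_mul_subset_left).trans (tsupport_comp_rescale_subset hs hU)
  have hwd : ∀ y : E3, HasFDerivAt (fun y : E3 => s⁻¹ • (y - x))
      (s⁻¹ • ContinuousLinearMap.id ℝ E3) y := fun y =>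
    ((hasFDerivAt_id y).sub_const x).const_smul s⁻¹
  have hφd : ∀ i y, fderiv ℝ (φ i) y (e i) =
      s⁻¹ ^ 4 * (fderiv ℝ ρ (s⁻¹ • (y - x)) (e i) * (s⁻¹ • (y - x)) i + ρ (s⁻¹ • (y - x))) := by
    intro i y
    have h1 := ((hρ.differentiable (by simp)) (s⁻¹ • (y - x))).hasFDerivAt.comp y (hwd y)
    have h2 := ((EuclideanSpace.proj (𝕜 := ℝ) i : E3 →L[ℝ] ℝ).hasFDerivAt.comp y (hwd y)).const_mul
      (s⁻¹ ^ 3)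
    have h3 := h1.mul h2
    have h4 : fderiv ℝ (φ i) y = _ := h3.fderiv
    rw [h4]
    simp [he]
    ring
  have hsum : ∀ y, s⁻¹ ^ 4 * divRadial ρ (s⁻¹ • (y - x)) = ∑ i, fderiv ℝ (φ i) y (e i) := by
    intro y
    set w := s⁻¹ • (y - x) with hw
    have h5 : fderiv ℝ ρ w w = ∑ i, fderiv ℝ ρ w (e i) * w i := by
      have h6 : w = ∑ i, w i • e i := by
        ext j; simp [he, Fin.sum_univ_three]; fin_cases j <;> simp
      calc fderiv ℝ ρ w w = fderiv ℝ ρ w (∑ i, w i • e i) := by rw [← h6]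
        _ = _ := by simp [mul_comm]
    simp only [hφd, ← hw, divRadial, h5, ← Finset.mul_sum, Finset.sum_add_distrib,
      Finset.sum_const, Finset.card_univ, Fintype.card_fin, nsmul_eq_mul]
    push_cast
    ring
  have hbd : ∀ i, ∃ A, 0 ≤ A ∧ ∀ y, |fderiv ℝ (φ i) y (e i)| ≤ A := fun i => by
    refine exists_bound_of_compactSupport
      (((hφs i).continuous_fderiv (by simp)).clm_apply continuous_const) ?_
    exact ((hφc i).fderiv (𝕜 := ℝ)).mono fun z hz h => hz (by simp [h])
  have hbd2 : ∀ i, ∃ A, 0 ≤ A ∧ ∀ y, |φ i y| ≤ A := fun i =>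
    exists_bound_of_compactSupport (hφs i).continuous (hφc i)
  choose A hA0 hA using hbd
  choose B hB0 hB using hbd2
  have hint1 : ∀ i, Integrable (fun y => fderiv ℝ (φ i) y (e i) • u y) (volume.restrict U) :=
    fun i => integrable_bdd_smul hu
      (((hφs i).continuous_fderiv (by simp)).clm_apply continuous_const) (hA i)
  have hint2 : ∀ i, Integrable (fun y => φ i y • G y (e i)) (volume.restrict U) := fun i =>
    integrable_bdd_smul (integrable_clm_apply hG continuous_const fun _ => le_rfl)
      (hφs i).continuous (hB i)
  calc -∫ y in U, (s⁻¹ ^ 4 * divRadial ρ (s⁻¹ • (y - x))) • u y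
      = -∫ y in U, ∑ i, fderiv ℝ (φ i) y (e i) • u y := by
        simp_rw [hsum, Finset.sum_smul]
    _ = ∑ i, -∫ y in U, fderiv ℝ (φ i) y (e i) • u y := by
        rw [integral_finsetSum _ fun i _ => hint1 i, Finset.sum_neg_distrib]
    _ = ∑ i, ∫ y in U, φ i y • G y (e i) := by
        refine Finset.sum_congr rfl fun i _ => ?_
        rw [huG.integral_eq (φ i) (hφs i) (hφc i) (hφt i) (e i), neg_neg]
    _ = _ := by
        rw [← integral_finsetSum _ fun i _ => hint2 i]
        refine integral_congr_ae (ae_of_all _ fun y => ?_)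
        have h6 : s⁻¹ • (y - x) = ∑ i, (s⁻¹ • (y - x)) i • e i := by
          ext j; simp [he, Fin.sum_univ_three]; fin_cases j <;> simp
        simp only [hφ]
        conv_rhs => rw [h6, map_sum, Finset.smul_sum]
        refine Finset.sum_congr rfl fun i _ => ?_
        rw [map_smul, smul_smul, ← h6]
        congr 1
        ring

/-- Averages of a function are differentiable in the base point, and their derivative is the average
of the weak derivative. -/
lemma hasFDerivAt_mollify [CompleteSpace F] {ρ : E3 → ℝ} (hρ : ContDiff ℝ ∞ ρ)
    (hc : HasCompactSupport ρ) {U : Set E3} {u : E3 → F} {G : E3 → E3 →L[ℝ] F} (huG : HasWeakFDeriv U u G)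
    (hu : IntegrableOn u U) (hG : IntegrableOn G U)
    {s : ℝ} (hs : 0 < s) {x : E3} (hU : ∀ w ∈ tsupport ρ, x + s • w ∈ U) :
    HasFDerivAt (mollify ρ U u s) (mollify ρ U G s x) x := by
  have hρc := hρ.continuous
  have hρd := hρ.continuous_fderiv (by simp)
  obtain ⟨A, hA0, hA⟩ := exists_bound_of_compactSupport hρ.continuous hc
  obtain ⟨B, hB⟩ := (hc.fderiv (𝕜 := ℝ)).exists_bound_of_continuous hρd
  have hB0 : 0 ≤ B := (norm_nonneg _).trans (hB 0)
  set k' : E3 → E3 → E3 →L[ℝ] ℝ := fun x y => (-(s⁻¹ ^ 4)) • fderiv ℝ ρ (s⁻¹ • (y - x)) with hk'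
  have hk'b : ∀ x y, ‖k' x y‖ ≤ s⁻¹ ^ 4 * B := fun x y => by
    rw [hk', norm_smul, norm_neg, Real.norm_eq_abs, abs_of_pos (by positivity)]
    gcongr; exact hB _
  have hk'c : ∀ x, Continuous (k' x) := fun x => by
    simp only [hk']; fun_prop
  have hmain : HasFDerivAt (mollify ρ U u s) (∫ y in U, (k' x y).smulRight (u y)) x := by
    refine hasFDerivAt_integral_of_dominated_of_fderiv_le (univ_mem)
      (F := fun x y => (s⁻¹ ^ 3 * ρ (s⁻¹ • (y - x))) • u y)
      (F' := fun x y => (k' x y).smulRight (u y))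
      (bound := fun y => (s⁻¹ ^ 4 * B) * ‖u y‖) ?_ ?_ ?_ ?_ ?_ ?_
    · exact Eventually.of_forall fun t =>
        (Continuous.aestronglyMeasurable (by fun_prop)).smul hu.1
    · refine integrable_bdd_smul hu (by fun_prop) (A := |s⁻¹ ^ 3| * A) fun y => ?_
      rw [abs_mul]; gcongr; exact hA _
    · exact (ContinuousLinearMap.smulRightL ℝ E3 F).aestronglyMeasurable_comp₂
        (hk'c x).aestronglyMeasurable hu.1
    · refine ae_of_all _ fun y t _ => ?_
      rw [ContinuousLinearMap.norm_smulRight_apply]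
      gcongr; exact hk'b _ _
    · exact hu.norm.const_mul _
    · refine ae_of_all _ fun y t _ => ?_
      have hwd : HasFDerivAt (fun x : E3 => s⁻¹ • (y - x))
          (s⁻¹ • (-ContinuousLinearMap.id ℝ E3)) t :=
        ((hasFDerivAt_id t).const_sub y).const_smul s⁻¹
      have h1 := (((hρ.differentiable (by simp)) (s⁻¹ • (y - t))).hasFDerivAt.comp t hwd).const_mul
        (s⁻¹ ^ 3)
      have h2 := h1.smul_const (u y)
      refine h2.congr_fderiv ?_
      ext v
      simp [hk', smul_smul]
      ring_nf
  convert hmain using 1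
  have hi1 : Integrable (fun y => (k' x y).smulRight (u y)) (volume.restrict U) := by
    refine (hu.norm.const_mul (s⁻¹ ^ 4 * B)).mono' ?_ (ae_of_all _ fun y => ?_)
    · exact (ContinuousLinearMap.smulRightL ℝ E3 F).aestronglyMeasurable_comp₂
        (hk'c x).aestronglyMeasurable hu.1
    · rw [ContinuousLinearMap.norm_smulRight_apply]
      gcongr; exact hk'b _ _
  have hi2 : Integrable (fun y => (s⁻¹ ^ 3 * ρ (s⁻¹ • (y - x))) • G y) (volume.restrict U) := by
    refine integrable_bdd_smul hG (by fun_prop) (A := |s⁻¹ ^ 3| * A) fun y => ?_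
    rw [abs_mul]; gcongr; exact hA _
  ext v
  rw [mollify, ContinuousLinearMap.integral_apply hi2, ContinuousLinearMap.integral_apply hi1]
  have hw := huG.integral_eq (fun y => s⁻¹ ^ 3 * ρ (s⁻¹ • (y - x)))
    (contDiff_const.mul (hρ.comp (by fun_prop)))
    ((hasCompactSupport_comp_rescale hc hs x).mul_left)
    ((tsupport_mul_subset_right).trans (tsupport_comp_rescale_subset hs hU)) v
  simp only [_root_.smul_apply]
  rw [← neg_eq_iff_eq_neg] at hw
  rw [← hw, ← integral_neg]
  refine integral_congr_ae (ae_of_all _ fun y => ?_)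
  have hwd : HasFDerivAt (fun y : E3 => s⁻¹ • (y - x)) (s⁻¹ • ContinuousLinearMap.id ℝ E3) y :=
    ((hasFDerivAt_id y).sub_const x).const_smul s⁻¹
  have h1 := (((hρ.differentiable (by simp)) (s⁻¹ • (y - x))).hasFDerivAt.comp y hwd).const_mul
        (s⁻¹ ^ 3)
  have h4 : fderiv ℝ (fun y => s⁻¹ ^ 3 * ρ (s⁻¹ • (y - x))) y = _ := h1.fderiv
  simp only [h4]
  simp [hk', smul_smul]
  ring_nf

/-! ### Morrey's estimate and convergence of averages -/

lemma volume_closedBall_real (x : E3) {r : ℝ} (hr : 0 ≤ r) :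
    volume.real (Metric.closedBall x r) = r ^ 3 * volume.real (Metric.ball (0 : E3) 1) := by
  rw [Measure.real, Measure.addHaar_closedBall volume x hr, ENNReal.toReal_mul,
    ENNReal.toReal_ofReal (by positivity)]
  simp [Measure.real]

/-- Hölder's inequality on a ball of radius `R s`. -/
lemma exists_setIntegral_closedBall_norm_le {F : Type*} [NormedAddCommGroup F] {q : ℝ}
    (hq : 3 < q) {R : ℝ} (hR : 0 ≤ R) :
    ∃ C, 0 ≤ C ∧ ∀ (U : Set E3) (G : E3 → F), MemLp G (ENNReal.ofReal q) (volume.restrict U) →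
      ∀ (x : E3) (s : ℝ), 0 < s → ∫ y in U ∩ Metric.closedBall x (R * s), ‖G y‖ ≤
        C * s ^ (3 - 3 / q) * (eLpNorm G (ENNReal.ofReal q) (volume.restrict U)).toReal := by
  set V := volume.real (Metric.ball (0 : E3) 1) with hV
  have hV0 : 0 ≤ V := measureReal_nonneg
  refine ⟨(R ^ 3 * V) ^ (1 - 1 / q), by positivity, fun U G hG x s hs => ?_⟩
  set B := Metric.closedBall x (R * s) with hB
  set μ := volume.restrict (U ∩ B) with hμ
  have hμU : μ ≤ volume.restrict U := Measure.restrict_mono inter_subset_left le_rfl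
  have hGμ : MemLp G (ENNReal.ofReal q) μ := hG.mono_measure hμU
  have h1 : ∫ y in U ∩ B, ‖G y‖ = (eLpNorm G 1 μ).toReal := by
    rw [integral_norm_eq_lintegral_enorm hGμ.1, eLpNorm_one_eq_lintegral_enorm]
  have h2 := eLpNorm_le_eLpNorm_mul_rpow_measure_univ (p := 1) (q := ENNReal.ofReal q) (μ := μ)
    (f := G) (by rw [ENNReal.one_le_ofReal]; linarith) hGμ.1
  have hBfin : volume B ≠ ⊤ := measure_closedBall_lt_top.ne
  have hexp : (0:ℝ) ≤ 1 - 1 / q := by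
    rw [sub_nonneg, div_le_one (by linarith)]; linarith
  have hμB : μ univ ≤ volume B := by
    rw [hμ, Measure.restrict_apply_univ]
    exact measure_mono inter_subset_right
  have h3 : eLpNorm G 1 μ ≤
      eLpNorm G (ENNReal.ofReal q) (volume.restrict U) * volume B ^ (1 - 1 / q) := by
    refine h2.trans ?_
    rw [ENNReal.toReal_one, ENNReal.toReal_ofReal (by linarith), div_one]
    gcongr
  have h4 := ENNReal.toReal_mono
    (ENNReal.mul_ne_top hG.2.ne (ENNReal.rpow_ne_top_of_nonneg hexp hBfin)) h3
  rw [h1]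
  refine h4.trans (le_of_eq ?_)
  have hs3 : (s ^ 3) ^ (1 - 1 / q) = s ^ (3 - 3 / q) := by
    rw [← Real.rpow_natCast, ← Real.rpow_mul hs.le]
    congr 1
    push_cast
    ring
  rw [ENNReal.toReal_mul, ← ENNReal.toReal_rpow]
  change _ * (volume.real B) ^ (1 - 1 / q) = _
  rw [volume_closedBall_real x (by positivity), ← hs3,
    show (R * s) ^ 3 * volume.real (Metric.ball (0 : E3) 1) = (R ^ 3 * V) * s ^ 3 by rw [hV]; ring,
    Real.mul_rpow (by positivity) (by positivity)]
  ring

lemma norm_setIntegral_le_of_support {F' : Type*} [NormedAddCommGroup F'] {U B : Set E3}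
    (hB : MeasurableSet B)
    {f : E3 → F} {v : E3 → F'} (hv : IntegrableOn v U) {A : ℝ}
    (h1 : ∀ y ∈ B, ‖f y‖ ≤ A * ‖v y‖) (h2 : ∀ y ∉ B, f y = 0) :
    ‖∫ y in U, f y‖ ≤ A * ∫ y in U ∩ B, ‖v y‖ := by
  rw [← integral_const_mul, ← setIntegral_indicator hB]
  refine norm_integral_le_of_norm_le ((hv.norm.const_mul A).indicator hB) (ae_of_all _ fun y => ?_)
  by_cases hy : y ∈ B
  · rw [indicator_of_mem hy]; exact h1 y hy
  · rw [indicator_of_notMem hy, h2 y hy, norm_zero]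

lemma exists_radius_of_compactSupport {ρ : E3 → ℝ} (hc : HasCompactSupport ρ) :
    ∃ R, 0 < R ∧ ∀ (s : ℝ), 0 < s → ∀ x y : E3, y ∉ Metric.closedBall x (R * s) →
      ρ (s⁻¹ • (y - x)) = 0 := by
  obtain ⟨R, hR, h⟩ := hc.isBounded.exists_pos_norm_le
  refine ⟨R, hR, fun s hs x y hy => ?_⟩
  by_contra hne
  apply hy
  have := h _ (subset_tsupport _ hne)
  rw [norm_smul, norm_inv, Real.norm_eq_abs, abs_of_pos hs, inv_mul_le_iff₀ hs] at this
  rwa [mem_closedBall_iff_norm, mul_comm]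

/-- Morrey's estimate for averages: the scale derivative at scale `t` is bounded by a multiple of
`t ^ (-3 / q) ‖G‖_q`, which is integrable at `0` because `q > 3`. The constant does not depend on the
domain, the function or the point. -/
lemma exists_norm_mollify_sub_mollify_le {ρ : E3 → ℝ} (hρ : ContDiff ℝ ∞ ρ)
    (hc : HasCompactSupport ρ) {q : ℝ} (hq : 3 < q) :
    ∃ C, 0 ≤ C ∧ ∀ (U : Set E3) (u : E3 → F) (G : E3 → E3 →L[ℝ] F), HasWeakFDeriv U u G →
      IntegrableOn u U → IntegrableOn G U → MemLp G (ENNReal.ofReal q) (volume.restrict U) →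
      ∀ (x : E3) (s₀ : ℝ), (∀ s : ℝ, 0 < s → s ≤ s₀ → ∀ w ∈ tsupport ρ, x + s • w ∈ U) →
      ∀ s' s : ℝ, 0 < s' → s' ≤ s → s ≤ s₀ → ‖mollify ρ U u s x - mollify ρ U u s' x‖ ≤
        C * s ^ (1 - 3 / q) * (eLpNorm G (ENNReal.ofReal q) (volume.restrict U)).toReal := by
  obtain ⟨R, hR, hsupp⟩ := exists_radius_of_compactSupport hc
  obtain ⟨A, hA0, hA⟩ := exists_bound_of_compactSupport hρ.continuous hc
  obtain ⟨C, hC0, hC⟩ := exists_setIntegral_closedBall_norm_le (F := E3 →L[ℝ] F) hq hR.le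
  have hexp : 0 < 1 - 3 / q := by
    rw [sub_pos, div_lt_one (by linarith)]; linarith
  refine ⟨A * R * C / (1 - 3 / q), by positivity, ?_⟩
  intro U u G huG hu hGi hG x s₀ hU s' s hs' hss hs
  set N := (eLpNorm G (ENNReal.ofReal q) (volume.restrict U)).toReal with hN
  have hN0 : 0 ≤ N := ENNReal.toReal_nonneg
  set f' : ℝ → F := fun t => ∫ y in U, (t⁻¹ ^ 3 * ρ (t⁻¹ • (y - x))) • G y (t⁻¹ • (y - x))
  have hderiv : ∀ t ∈ Icc s' s, HasDerivAt (fun t => mollify ρ U u t x) (f' t) t := by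
    intro t ht
    have ht0 : 0 < t := hs'.trans_le ht.1
    have := hasDerivAt_mollify hρ hc hu ht0 x
    rwa [integral_divRadial_smul hρ hc huG hu hGi ht0 (hU t ht0 (ht.2.trans hs))] at this
  have hbound : ∀ t ∈ Icc s' s, ‖f' t‖ ≤ A * R * C * N * t ^ (-(3 / q)) := by
    intro t ht
    have ht0 : 0 < t := hs'.trans_le ht.1
    have h1 : ‖f' t‖ ≤ (t⁻¹ ^ 3 * A * R) * ∫ y in U ∩ Metric.closedBall x (R * t), ‖G y‖ := by
      refine norm_setIntegral_le_of_support Metric.isClosed_closedBall.measurableSet hGi ?_ ?_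
      · intro y hy
        have hw : ‖t⁻¹ • (y - x)‖ ≤ R := by
          rw [norm_smul, norm_inv, Real.norm_eq_abs, abs_of_pos ht0, inv_mul_le_iff₀ ht0,
            mul_comm t R]
          rwa [mem_closedBall_iff_norm] at hy
        rw [norm_smul, norm_mul, Real.norm_eq_abs, Real.norm_eq_abs, abs_of_pos (by positivity)]
        calc t⁻¹ ^ 3 * |ρ (t⁻¹ • (y - x))| * ‖G y (t⁻¹ • (y - x))‖
            ≤ t⁻¹ ^ 3 * A * (‖G y‖ * R) := by
              gcongr
              · exact hA _
              · exact (G y).le_of_opNorm_le_of_le le_rfl hw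
          _ = _ := by ring
      · intro y hy
        rw [hsupp t ht0 x y hy]; simp
    refine h1.trans ((mul_le_mul_of_nonneg_left (hC U G hG x t ht0) (by positivity)).trans
      (le_of_eq ?_))
    rw [Real.rpow_sub ht0, Real.rpow_neg ht0.le, ← hN]
    have : t ^ (3:ℝ) = t ^ 3 := by norm_cast
    rw [this]
    have h2 : t ^ (3 / q) ≠ 0 := (Real.rpow_pos_of_pos ht0 _).ne'
    field_simp
  have hsub : ∀ t ∈ Ico s' s, t ∈ Icc s' s := fun t ht => ⟨ht.1, ht.2.le⟩
  have hBd : ∀ t ∈ Icc s' s, HasDerivAt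
      (fun t : ℝ => A * R * C * N / (1 - 3 / q) * (t ^ (1 - 3 / q) - s' ^ (1 - 3 / q)))
      (A * R * C * N * t ^ (-(3 / q))) t := by
    intro t ht
    have ht0 : 0 < t := hs'.trans_le ht.1
    have := ((Real.hasDerivAt_rpow_const (p := 1 - 3 / q) (Or.inl ht0.ne')).sub_const
      (s' ^ (1 - 3 / q))).const_mul (A * R * C * N / (1 - 3 / q))
    refine this.congr_deriv ?_
    rw [show 1 - 3 / q - 1 = -(3 / q) by ring, ← mul_assoc, div_mul_cancel₀ _ hexp.ne']
  have key := image_norm_le_of_norm_deriv_right_le_deriv_boundary'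
    (f := fun t => mollify ρ U u t x - mollify ρ U u s' x) (a := s') (b := s) (f' := f')
    (fun t ht => ((hderiv t ht).sub_const _).continuousAt.continuousWithinAt)
    (fun t ht => ((hderiv t (hsub t ht)).sub_const _).hasDerivWithinAt)
    (B := fun t : ℝ => A * R * C * N / (1 - 3 / q) * (t ^ (1 - 3 / q) - s' ^ (1 - 3 / q)))
    (B' := fun t => A * R * C * N * t ^ (-(3 / q)))
    (by simp)
    (fun t ht => (hBd t ht).continuousAt.continuousWithinAt)
    (fun t ht => (hBd t (hsub t ht)).hasDerivWithinAt)
    (fun t ht => hbound t (hsub t ht)) (right_mem_Icc.2 hss)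
  refine key.trans ?_
  calc A * R * C * N / (1 - 3 / q) * (s ^ (1 - 3 / q) - s' ^ (1 - 3 / q))
      ≤ A * R * C * N / (1 - 3 / q) * s ^ (1 - 3 / q) := by
        gcongr
        simp only [tsub_le_iff_right, le_add_iff_nonneg_right]
        positivity
    _ = _ := by ring

lemma exists_norm_mollify_le {ρ : E3 → ℝ} (hρ : Continuous ρ)
    (hc : HasCompactSupport ρ) {q : ℝ} (hq : 3 < q) {s : ℝ} (hs : 0 < s) :
    ∃ C, 0 ≤ C ∧ ∀ (U : Set E3) (u : E3 → F), IntegrableOn u U →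
      MemLp u (ENNReal.ofReal q) (volume.restrict U) → ∀ x, ‖mollify ρ U u s x‖ ≤
        C * (eLpNorm u (ENNReal.ofReal q) (volume.restrict U)).toReal := by
  obtain ⟨R, hR, hsupp⟩ := exists_radius_of_compactSupport hc
  obtain ⟨A, hA0, hA⟩ := exists_bound_of_compactSupport hρ hc
  obtain ⟨C, hC0, hC⟩ := exists_setIntegral_closedBall_norm_le (F := F) hq hR.le
  refine ⟨s⁻¹ ^ 3 * A * (C * s ^ (3 - 3 / q)), by positivity, fun U u hui hu x => ?_⟩
  have h1 : ‖mollify ρ U u s x‖ ≤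
      (s⁻¹ ^ 3 * A) * ∫ y in U ∩ Metric.closedBall x (R * s), ‖u y‖ := by
    refine norm_setIntegral_le_of_support Metric.isClosed_closedBall.measurableSet hui ?_ ?_
    · intro y hy
      rw [norm_smul, norm_mul, Real.norm_eq_abs, Real.norm_eq_abs, abs_of_pos (by positivity)]
      gcongr
      exact hA _
    · intro y hy
      rw [hsupp s hs x y hy]; simp
  refine h1.trans ((mul_le_mul_of_nonneg_left (hC U u hu x s hs) (by positivity)).trans
      (le_of_eq ?_))
  ring

lemma integral_kernel {ρ : E3 → ℝ} (h1 : ∫ z, ρ z = 1) {U : Set E3} {s : ℝ} (hs : 0 < s) {x : E3}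
    (hU : ∀ w ∈ tsupport ρ, x + s • w ∈ U) :
    ∫ y in U, s⁻¹ ^ 3 * ρ (s⁻¹ • (y - x)) = 1 := by
  rw [setIntegral_eq_integral_of_forall_compl_eq_zero]
  · rw [integral_const_mul, integral_sub_right_eq_self (fun y => ρ (s⁻¹ • y)) x,
      Measure.integral_comp_smul, h1]
    simp [abs_of_pos hs]
    field_simp
  · intro y hy
    have : ρ (s⁻¹ • (y - x)) = 0 := by
      by_contra hne
      exact hy (tsupport_comp_rescale_subset hs hU (subset_tsupport _ hne))
    rw [this, mul_zero]

/-- The averages at `x` converge to `c` as soon as the mean of `‖u - c‖` over small balls does to `0`. -/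
lemma tendsto_mollify_of_tendsto_setIntegral [CompleteSpace F] {ρ : E3 → ℝ} (hρ : Continuous ρ)
    (hc : HasCompactSupport ρ)
    (h1 : ∫ z, ρ z = 1) {U : Set E3} (hUfin : volume U ≠ ⊤) {u : E3 → F} (hu : IntegrableOn u U)
    {x : E3} {s₀ : ℝ} (hs₀ : 0 < s₀)
    (hU : ∀ s, 0 < s → s ≤ s₀ → ∀ w ∈ tsupport ρ, x + s • w ∈ U) {c : F}
    (h : ∀ R : ℝ, 0 < R → Tendsto (fun s : ℝ => s⁻¹ ^ 3 *
      ∫ y in U ∩ Metric.closedBall x (R * s), ‖u y - c‖) (𝓝[>] 0) (𝓝 0)) :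
    Tendsto (fun s => mollify ρ U u s x) (𝓝[>] 0) (𝓝 c) := by
  obtain ⟨R, hR, hsupp⟩ := exists_radius_of_compactSupport hc
  obtain ⟨A, hA0, hA⟩ := exists_bound_of_compactSupport hρ hc
  rw [tendsto_iff_norm_sub_tendsto_zero]
  have hlim := (h R hR).const_mul A
  rw [mul_zero] at hlim
  refine squeeze_zero' (Eventually.of_forall fun _ => norm_nonneg _) ?_ hlim
  filter_upwards [Ioc_mem_nhdsGT hs₀] with s hs
  have hci : IntegrableOn (fun _ : E3 => c) U := integrableOn_const hUfin
  have hbd : ∀ y, |s⁻¹ ^ 3 * ρ (s⁻¹ • (y - x))| ≤ |s⁻¹ ^ 3| * A := fun y => by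
    rw [abs_mul]; gcongr; exact hA _
  have e1 : mollify ρ U u s x - c = ∫ y in U, (s⁻¹ ^ 3 * ρ (s⁻¹ • (y - x))) • (u y - c) := by
    simp_rw [smul_sub (_ * ρ _)]
    rw [integral_sub (integrable_bdd_smul hu (by fun_prop) hbd)
      (integrable_bdd_smul hci (by fun_prop) hbd), integral_smul_const,
      integral_kernel h1 hs.1 (hU s hs.1 hs.2), one_smul]
    rfl
  rw [e1]
  have h2 := norm_setIntegral_le_of_support (F := F) (U := U) (B := Metric.closedBall x (R * s))
    Metric.isClosed_closedBall.measurableSet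
    (f := fun y => (s⁻¹ ^ 3 * ρ (s⁻¹ • (y - x))) • (u y - c)) (v := fun y => u y - c)
    (hu.sub hci) (A := s⁻¹ ^ 3 * A) ?_ ?_
  · refine h2.trans (le_of_eq (by ring))
  · intro y hy
    have hs0 := hs.1
    rw [norm_smul, norm_mul, Real.norm_eq_abs, Real.norm_eq_abs, abs_of_pos (by positivity)]
    gcongr
    exact hA _
  · intro y hy
    rw [hsupp s hs.1 x y hy]; simp

lemma tendsto_mollify_of_tendsto [CompleteSpace F] {ρ : E3 → ℝ} (hρ : Continuous ρ)
    (hc : HasCompactSupport ρ)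
    (h1 : ∫ z, ρ z = 1) {U : Set E3} (hUfin : volume U ≠ ⊤)
    {u : E3 → F} (hu : IntegrableOn u U)
    {x : E3} {s₀ : ℝ} (hs₀ : 0 < s₀)
    (hU : ∀ s, 0 < s → s ≤ s₀ → ∀ w ∈ tsupport ρ, x + s • w ∈ U) {c : F}
    (h : Tendsto u (𝓝[U] x) (𝓝 c)) :
    Tendsto (fun s => mollify ρ U u s x) (𝓝[>] 0) (𝓝 c) := by
  refine tendsto_mollify_of_tendsto_setIntegral hρ hc h1 hUfin hu hs₀ hU fun R hR => ?_
  set V := volume.real (Metric.ball (0 : E3) 1) with hV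
  have hV0 : 0 ≤ V := measureReal_nonneg
  rw [Metric.tendsto_nhds]
  intro ε hε
  have hε' : 0 < ε / (R ^ 3 * V + 1) := by positivity
  have h3 := Metric.tendsto_nhds.1 h _ hε'
  rw [eventually_nhdsWithin_iff, Metric.eventually_nhds_iff] at h3
  obtain ⟨η, hη, h3⟩ := h3
  filter_upwards [Ioo_mem_nhdsGT (show 0 < η / R by positivity)] with s hs
  have hs0 := hs.1
  have hRs : R * s < η := by rw [mul_comm]; exact (lt_div_iff₀ hR).1 hs.2
  have h4 : ∫ y in U ∩ Metric.closedBall x (R * s), ‖u y - c‖ ≤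
      ε / (R ^ 3 * V + 1) * volume.real (Metric.closedBall x (R * s)) := by
    have h5 := norm_setIntegral_le_of_norm_le_const (μ := volume)
      (s := U ∩ Metric.closedBall x (R * s)) (f := fun y => ‖u y - c‖) (C := ε / (R ^ 3 * V + 1))
      ((measure_mono inter_subset_right).trans_lt measure_closedBall_lt_top)
      (fun y hy => by
        rw [norm_norm, ← dist_eq_norm]
        exact (h3 (lt_of_le_of_lt hy.2 hRs) hy.1).le)
    refine (le_abs_self _).trans (h5.trans ?_)
    gcongr
    · exact measure_closedBall_lt_top.ne
    · exact inter_subset_right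
  rw [volume_closedBall_real x (by positivity)] at h4
  have h6 : 0 ≤ ∫ y in U ∩ Metric.closedBall x (R * s), ‖u y - c‖ :=
    integral_nonneg fun _ => norm_nonneg _
  rw [Real.dist_eq, sub_zero, abs_of_nonneg (by positivity)]
  calc s⁻¹ ^ 3 * ∫ y in U ∩ Metric.closedBall x (R * s), ‖u y - c‖
      ≤ s⁻¹ ^ 3 * (ε / (R ^ 3 * V + 1) * ((R * s) ^ 3 * V)) := by gcongr
    _ = ε * ((R ^ 3 * V) / (R ^ 3 * V + 1)) := by field_simp
    _ < ε * 1 := by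
        gcongr
        rw [div_lt_one (by positivity)]; linarith
    _ = ε := mul_one ε

/-- At a Lebesgue point the averages converge for every kernel at once. -/
lemma ae_tendsto_mollify [CompleteSpace F] {U : Set E3} (hUfin : volume U ≠ ⊤) (hUo : IsOpen U)
    {u : E3 → F} (hu : IntegrableOn u U) :
    ∀ᵐ x ∂(volume.restrict U), ∀ ρ : E3 → ℝ, Continuous ρ → HasCompactSupport ρ → ∫ z, ρ z = 1 →
      ∀ s₀ : ℝ, 0 < s₀ → (∀ s : ℝ, 0 < s → s ≤ s₀ → ∀ w ∈ tsupport ρ, x + s • w ∈ U) →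
      Tendsto (fun s => mollify ρ U u s x) (𝓝[>] 0) (𝓝 (u x)) := by
  have hleb := IsUnifLocDoublingMeasure.ae_tendsto_average_norm_sub (volume : Measure E3)
    (f := U.indicator u) (hu.integrable_indicator hUo.measurableSet).locallyIntegrable 1
  rw [ae_restrict_iff' hUo.measurableSet]
  filter_upwards [hleb] with x hx hxU
  intro ρ hρ hc h1 s₀ hs₀ hU
  refine tendsto_mollify_of_tendsto_setIntegral hρ hc h1 hUfin hu hs₀ hU fun R hR => ?_
  set V := volume.real (Metric.ball (0 : E3) 1) with hV
  have hV0 : 0 < V := by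
    rw [hV, Measure.real]
    exact ENNReal.toReal_pos (Metric.measure_ball_pos _ _ one_pos).ne' measure_ball_lt_top.ne
  have hlim := (hx (fun _ : ℝ => x) (fun s : ℝ => R * s) (l := 𝓝[>] 0) ?_ ?_).const_mul (R ^ 3 * V)
  · rw [mul_zero] at hlim
    refine squeeze_zero' ?_ ?_ hlim
    · filter_upwards [self_mem_nhdsWithin] with s hs
      have : (0:ℝ) < s := hs
      have h6 : 0 ≤ ∫ y in U ∩ Metric.closedBall x (R * s), ‖u y - u x‖ :=
        integral_nonneg fun _ => norm_nonneg _
      positivity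
    · filter_upwards [self_mem_nhdsWithin] with s hs
      have hs0 : (0:ℝ) < s := hs
      rw [setAverage_eq, volume_closedBall_real x (by positivity), ← hV, smul_eq_mul]
      have h7 : ∫ y in U ∩ Metric.closedBall x (R * s), ‖u y - u x‖ ≤
          ∫ y in Metric.closedBall x (R * s), ‖U.indicator u y - U.indicator u x‖ := by
        have h8 : ∫ y in U ∩ Metric.closedBall x (R * s), ‖u y - u x‖ =
            ∫ y in U ∩ Metric.closedBall x (R * s), ‖U.indicator u y - U.indicator u x‖ := by
          refine setIntegral_congr_fun
            (hUo.measurableSet.inter Metric.isClosed_closedBall.measurableSet) fun y hy => ?_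
          simp only [indicator_of_mem hy.1, indicator_of_mem hxU]
        rw [h8]
        refine setIntegral_mono_set ?_ (ae_of_all _ fun _ => norm_nonneg _)
          (Eventually.of_forall inter_subset_right)
        exact ((hu.integrable_indicator hUo.measurableSet).integrableOn.sub
          (integrableOn_const measure_closedBall_lt_top.ne)).norm
      calc _ ≤ s⁻¹ ^ 3 * ∫ y in Metric.closedBall x (R * s), ‖U.indicator u y - U.indicator u x‖ := by
            gcongr
        _ = _ := by field_simp
  · refine tendsto_nhdsWithin_iff.2 ⟨?_, ?_⟩
    · have : Tendsto (fun s : ℝ => R * s) (𝓝 0) (𝓝 (R * 0)) := by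
        exact (continuous_const.mul continuous_id).tendsto 0
      rw [mul_zero] at this
      exact this.mono_left nhdsWithin_le_nhds
    · filter_upwards [self_mem_nhdsWithin] with s hs
      exact mul_pos hR hs
  · filter_upwards [self_mem_nhdsWithin] with s hs
    have : (0:ℝ) < s := hs
    exact Metric.mem_closedBall_self (by positivity)

/-! ### Regularity up to the boundary -/

/-- `e` points into `U` at all points of `closure U` near `x₀`, uniformly: from each of them, the cone
around `e` with opening `δ` and height `t₀` stays in `U`. For `x₀ ∈ U` the choice `e = 0` is allowed. -/
structure HasInwardCone (U : Set E3) (x₀ e : E3) (δ t₀ r : ℝ) : Prop where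
  δ_pos : 0 < δ
  t_pos : 0 < t₀
  r_pos : 0 < r
  subset : ∀ x ∈ closure U ∩ Metric.ball x₀ r, ∀ t : ℝ, 0 < t → t ≤ t₀ →
    Metric.closedBall (x + t • e) (t * δ) ⊆ U

lemma exists_hasInwardCone_of_mem {U : Set E3} (hU : IsOpen U) {x : E3} (hx : x ∈ U) :
    ∃ e δ t₀ r, HasInwardCone U x e δ t₀ r := by
  obtain ⟨r, hr, hrU⟩ := Metric.isOpen_iff.1 hU x hx
  refine ⟨0, 1, r / 4, r / 2, one_pos, by positivity, by positivity, fun y hy t ht htr z hz => hrU ?_⟩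
  have h1 := hy.2
  simp only [smul_zero, add_zero, mul_one, Metric.mem_closedBall, Metric.mem_ball] at hz h1 ⊢
  have := dist_triangle z y x
  linarith

/-- `ρ` is a normalised smooth kernel whose translates to points of `V`, rescaled by factors at
most `t₀`, are supported in `U`. -/
structure IsInwardKernel (ρ : E3 → ℝ) (U V : Set E3) (t₀ : ℝ) : Prop where
  contDiff : ContDiff ℝ ∞ ρ
  hasCompactSupport : HasCompactSupport ρ
  integral_eq_one : ∫ z, ρ z = 1
  pos : 0 < t₀
  mem : ∀ x ∈ V, ∀ s : ℝ, 0 < s → s ≤ t₀ → ∀ w ∈ tsupport ρ, x + s • w ∈ U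

lemma HasInwardCone.exists_kernel {U : Set E3} {x₀ e : E3} {δ t₀ r : ℝ}
    (h : HasInwardCone U x₀ e δ t₀ r) :
    ∃ ρ, IsInwardKernel ρ U (closure U ∩ Metric.ball x₀ r) t₀ := by
  let φ : ContDiffBump e := ⟨δ / 2, δ, half_pos h.δ_pos, half_lt_self h.δ_pos⟩
  refine ⟨φ.normed volume, φ.contDiff_normed, φ.hasCompactSupport_normed, φ.integral_normed,
    h.t_pos, fun x hx s hs hst w hw => h.subset x hx s hs hst ?_⟩
  rw [φ.tsupport_normed_eq, mem_closedBall_iff_norm] at hw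
  rw [mem_closedBall_iff_norm, show x + s • w - (x + s • e) = s • (w - e) by module, norm_smul,
    Real.norm_eq_abs, abs_of_pos hs]
  gcongr

/-- On a set with an inward kernel, the averages of a function in `W^{1,q}`, `q > 3`, converge
uniformly, to a limit bounded by the `W^{1,q}` norm. -/
lemma exists_tendstoUniformlyOn_mollify [CompleteSpace F] {q : ℝ} (hq : 3 < q) {U V : Set E3}
    (hUfin : volume U ≠ ⊤) {ρ : E3 → ℝ} {t₀ : ℝ} (hρ : IsInwardKernel ρ U V t₀) :
    ∃ C, 0 ≤ C ∧ ∀ (u : E3 → F) (G : E3 → E3 →L[ℝ] F), HasWeakFDeriv U u G →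
      MemLp u (ENNReal.ofReal q) (volume.restrict U) →
      MemLp G (ENNReal.ofReal q) (volume.restrict U) →
      ∃ u₀ : E3 → F, TendstoUniformlyOn (fun s => mollify ρ U u s) u₀ (𝓝[>] 0) V ∧
        ∀ x ∈ V, ‖u₀ x‖ ≤ C * ((eLpNorm u (ENNReal.ofReal q) (volume.restrict U)).toReal +
          (eLpNorm G (ENNReal.ofReal q) (volume.restrict U)).toReal) := by
  obtain ⟨C₁, hC₁, hM⟩ := exists_norm_mollify_sub_mollify_le (F := F) hρ.contDiff
    hρ.hasCompactSupport hq
  obtain ⟨C₂, hC₂, hT⟩ := exists_norm_mollify_le (F := F) hρ.contDiff.continuous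
    hρ.hasCompactSupport hq hρ.pos
  have hexp : 0 < 1 - 3 / q := by
    rw [sub_pos, div_lt_one (by linarith)]; linarith
  have ht₀ := hρ.pos
  refine ⟨C₂ + C₁ * t₀ ^ (1 - 3 / q), by positivity, fun u G huG hu hG => ?_⟩
  have : IsFiniteMeasure (volume.restrict U) := ⟨by simpa using hUfin.lt_top⟩
  have hq1 : (1 : ℝ≥0∞) ≤ ENNReal.ofReal q := by rw [ENNReal.one_le_ofReal]; linarith
  have hui : IntegrableOn u U := hu.integrable hq1
  have hGi : IntegrableOn G U := hG.integrable hq1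
  set N := (eLpNorm G (ENNReal.ofReal q) (volume.restrict U)).toReal with hN
  have hN0 : 0 ≤ N := ENNReal.toReal_nonneg
  have hdiff : ∀ x ∈ V, ∀ s' s : ℝ, 0 < s' → s' ≤ s → s ≤ t₀ →
      ‖mollify ρ U u s x - mollify ρ U u s' x‖ ≤ C₁ * s ^ (1 - 3 / q) * N :=
    fun x hx => hM U u G huG hui hGi hG x t₀ (hρ.mem x hx)
  have hsmall : Tendsto (fun s : ℝ => C₁ * s ^ (1 - 3 / q) * N) (𝓝[>] 0) (𝓝 0) := by
    have : Continuous fun s : ℝ => C₁ * s ^ (1 - 3 / q) * N :=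
      (continuous_const.mul (Real.continuous_rpow_const hexp.le)).mul continuous_const
    have h2 := this.tendsto 0
    simp only [Real.zero_rpow hexp.ne', mul_zero, zero_mul] at h2
    exact h2.mono_left nhdsWithin_le_nhds
  have hlim : ∀ x ∈ V, ∃ c, Tendsto (fun s => mollify ρ U u s x) (𝓝[>] 0) (𝓝 c) := by
    intro x hx
    refine cauchy_map_iff_exists_tendsto.1 (Metric.cauchy_iff.2 ⟨inferInstance, fun ε hε => ?_⟩)
    obtain ⟨s, hs1, hs2⟩ := ((hsmall.eventually_lt_const (half_pos hε)).and
      (Ioc_mem_nhdsGT ht₀)).exists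
    refine ⟨(fun s => mollify ρ U u s x) '' Ioc 0 s, image_mem_map (Ioc_mem_nhdsGT hs2.1), ?_⟩
    rintro _ ⟨a, ha, rfl⟩ _ ⟨b, hb, rfl⟩
    have h1 := hdiff x hx a s ha.1 ha.2 hs2.2
    have h2 := hdiff x hx b s hb.1 hb.2 hs2.2
    rw [← dist_eq_norm] at h1 h2
    have := dist_triangle_left (mollify ρ U u a x) (mollify ρ U u b x) (mollify ρ U u s x)
    linarith
  choose! u₀ hu₀ using hlim
  have hrate : ∀ x ∈ V, ∀ s, 0 < s → s ≤ t₀ →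
      ‖mollify ρ U u s x - u₀ x‖ ≤ C₁ * s ^ (1 - 3 / q) * N := by
    intro x hx s hs hst
    refine le_of_tendsto ((tendsto_const_nhds.sub (hu₀ x hx)).norm) ?_
    filter_upwards [Ioc_mem_nhdsGT hs] with s' hs'
    exact hdiff x hx s' s hs'.1 hs'.2 hst
  refine ⟨u₀, ?_, fun x hx => ?_⟩
  · rw [Metric.tendstoUniformlyOn_iff]
    intro ε hε
    filter_upwards [hsmall.eventually_lt_const hε, Ioc_mem_nhdsGT ht₀] with s hs1 hs2 x hx
    rw [dist_comm, dist_eq_norm]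
    exact (hrate x hx s hs2.1 hs2.2).trans_lt hs1
  · have h1 := hrate x hx t₀ ht₀ le_rfl
    have h2 := hT U u hui hu x
    set M := (eLpNorm u (ENNReal.ofReal q) (volume.restrict U)).toReal
    have hM0 : 0 ≤ M := ENNReal.toReal_nonneg
    calc ‖u₀ x‖ = ‖mollify ρ U u t₀ x - (mollify ρ U u t₀ x - u₀ x)‖ := by rw [sub_sub_cancel]
      _ ≤ C₂ * M + C₁ * t₀ ^ (1 - 3 / q) * N := (norm_sub_le _ _).trans (add_le_add h2 h1)
      _ ≤ (C₂ + C₁ * t₀ ^ (1 - 3 / q)) * (M + N) := by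
        have : 0 ≤ C₁ * t₀ ^ (1 - 3 / q) * M := by positivity
        have : 0 ≤ C₂ * N := by positivity
        nlinarith

lemma hasWeakFDeriv_weakFDeriv {U : Set E3} {f : E3 → F} (h : ∃ g, HasWeakFDeriv U f g) :
    HasWeakFDeriv U f (weakFDeriv U f) := by
  rw [weakFDeriv, dif_pos h]
  exact h.choose_spec

/-- Local form of the embedding of `W^{2,q}` into `C¹` up to the boundary: the averages of the weak
derivative converge uniformly, and their limit `g` is the classical derivative. -/
lemma exists_continuousOn_hasFDerivAt [CompleteSpace F] {q : ℝ} (hq : 3 < q) {U : Set E3}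
    (hUo : IsOpen U) (hUfin : volume U ≠ ⊤) {x₀ : E3} {r : ℝ} {ρ : E3 → ℝ} {t₀ : ℝ}
    (hρ : IsInwardKernel ρ U (closure U ∩ Metric.ball x₀ r) t₀) :
    ∃ C, 0 ≤ C ∧ ∀ f : E3 → F, MemW2 q U f → ContinuousOn f (closure U) →
      ∃ g : E3 → E3 →L[ℝ] F, ContinuousOn g (closure U ∩ Metric.ball x₀ r) ∧
        TendstoUniformlyOn (fun s => mollify ρ U (weakFDeriv U f) s) g (𝓝[>] 0)
          (closure U ∩ Metric.ball x₀ r) ∧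
        (∀ x ∈ U ∩ Metric.ball x₀ r, HasFDerivAt f (g x) x) ∧
        ∀ x ∈ closure U ∩ Metric.ball x₀ r,
          ‖f x‖ ≤ C * (normW2 q U f).toReal ∧ ‖g x‖ ≤ C * (normW2 q U f).toReal := by
  obtain ⟨C₁, hC₁, h1⟩ := exists_tendstoUniformlyOn_mollify (F := F) hq hUfin hρ
  obtain ⟨C₂, hC₂, h2⟩ := exists_tendstoUniformlyOn_mollify (F := E3 →L[ℝ] F) hq hUfin hρ
  have ht₀ := hρ.pos
  refine ⟨max C₁ C₂, by positivity, fun f hf hfc => ?_⟩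
  have : IsFiniteMeasure (volume.restrict U) := ⟨by simpa using hUfin.lt_top⟩
  have hq1 : (1 : ℝ≥0∞) ≤ ENNReal.ofReal q := by rw [ENNReal.one_le_ofReal]; linarith
  have hw1 := hasWeakFDeriv_weakFDeriv hf.hasWeakFDeriv
  have hw2 := hasWeakFDeriv_weakFDeriv hf.hasWeakFDeriv_two
  have hfi : IntegrableOn f U := hf.memLp.integrable hq1
  have hf1i : IntegrableOn (weakFDeriv U f) U := hf.memLp_one.integrable hq1
  obtain ⟨f₀, hf₀, hf₀b⟩ := h1 f _ hw1 hf.memLp hf.memLp_one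
  obtain ⟨g, hg, hgb⟩ := h2 _ _ hw2 hf.memLp_one hf.memLp_two
  have hlimf : ∀ x ∈ closure U ∩ Metric.ball x₀ r,
      Tendsto (fun s => mollify ρ U f s x) (𝓝[>] 0) (𝓝 (f x)) := fun x hx =>
    tendsto_mollify_of_tendsto hρ.contDiff.continuous hρ.hasCompactSupport hρ.integral_eq_one hUfin
      hfi ht₀ (hρ.mem x hx) ((hfc x hx.1).mono subset_closure)
  have hfin1 := hf.memLp.2.ne
  have hfin2 := hf.memLp_one.2.ne
  have hfin3 := hf.memLp_two.2.ne
  have hN : (normW2 q U f).toReal = (eLpNorm f (ENNReal.ofReal q) (volume.restrict U)).toReal +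
      (eLpNorm (weakFDeriv U f) (ENNReal.ofReal q) (volume.restrict U)).toReal +
      (eLpNorm (weakFDeriv U (weakFDeriv U f)) (ENNReal.ofReal q) (volume.restrict U)).toReal := by
    rw [normW2, ENNReal.toReal_add (ENNReal.add_ne_top.2 ⟨hfin1, hfin2⟩) hfin3,
      ENNReal.toReal_add hfin1 hfin2]
  refine ⟨g, ?_, hg, ?_, ?_⟩
  · refine hg.continuousOn (Eventually.of_forall fun s => ?_).frequently
    exact (continuous_mollify hρ.contDiff.continuous hρ.hasCompactSupport hf1i s).continuousOn
  · intro x hx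
    have hsub : U ∩ Metric.ball x₀ r ⊆ closure U ∩ Metric.ball x₀ r :=
      inter_subset_inter_left _ subset_closure
    have hseq : Tendsto (fun n : ℕ => t₀ / ((n : ℝ) + 1)) atTop (𝓝[>] 0) := by
      refine tendsto_nhdsWithin_iff.2 ⟨?_, Eventually.of_forall fun n => ?_⟩
      · have := (tendsto_one_div_add_atTop_nhds_zero_nat (𝕜 := ℝ)).const_mul t₀
        simpa [div_eq_mul_inv] using this
      · exact div_pos ht₀ (by positivity)
    refine hasFDerivAt_of_tendstoUniformlyOn (l := atTop)
      (f := fun n : ℕ => mollify ρ U f (t₀ / ((n : ℝ) + 1)))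
      (f' := fun n : ℕ => mollify ρ U (weakFDeriv U f) (t₀ / ((n : ℝ) + 1)))
      (hUo.inter Metric.isOpen_ball)
      (fun v hv => hseq.eventually ((hg.mono hsub) v hv)) (fun n y hy => ?_)
      (fun y hy => (hlimf y (hsub hy)).comp hseq) hx
    have hn : 0 < t₀ / ((n : ℝ) + 1) := div_pos ht₀ (by positivity)
    refine hasFDerivAt_mollify hρ.contDiff hρ.hasCompactSupport hw1 hfi hf1i hn
      (hρ.mem y (hsub hy) _ hn ?_)
    exact div_le_self ht₀.le (by linarith [(Nat.cast_nonneg n : (0:ℝ) ≤ n)])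
  · intro x hx
    have e1 : f x = f₀ x := tendsto_nhds_unique (hlimf x hx) (hf₀.tendsto_at hx)
    rw [hN]
    have p1 : 0 ≤ (eLpNorm f (ENNReal.ofReal q) (volume.restrict U)).toReal := ENNReal.toReal_nonneg
    have p3 : 0 ≤ (eLpNorm (weakFDeriv U (weakFDeriv U f)) (ENNReal.ofReal q)
      (volume.restrict U)).toReal := ENNReal.toReal_nonneg
    have p2 : 0 ≤ (eLpNorm (weakFDeriv U f) (ENNReal.ofReal q)
      (volume.restrict U)).toReal := ENNReal.toReal_nonneg
    constructor
    · rw [e1]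
      exact (hf₀b x hx).trans (mul_le_mul (le_max_left _ _) (by linarith) (by positivity)
        (by positivity))
    · exact (hgb x hx).trans (mul_le_mul (le_max_right _ _) (by linarith) (by positivity)
        (by positivity))

/-- Both derivatives are limits of the same averages at each Lebesgue point of the weak one. -/
lemma ae_hasFDerivAt_weakFDeriv [CompleteSpace F] {q : ℝ} (hq : 3 < q) {U : Set E3}
    (hUo : IsOpen U) (hUfin : volume U ≠ ⊤) {f : E3 → F} (hf : MemW2 q U f)
    (hfc : ContinuousOn f (closure U)) :
    ∀ᵐ x ∂(volume.restrict U), HasFDerivAt f (weakFDeriv U f x) x := by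
  have : IsFiniteMeasure (volume.restrict U) := ⟨by simpa using hUfin.lt_top⟩
  have hq1 : (1 : ℝ≥0∞) ≤ ENNReal.ofReal q := by rw [ENNReal.one_le_ofReal]; linarith
  filter_upwards [ae_tendsto_mollify hUfin hUo (hf.memLp_one.integrable hq1),
    ae_restrict_mem hUo.measurableSet] with x hx hxU
  obtain ⟨e, δ, t₀, r, hcone⟩ := exists_hasInwardCone_of_mem hUo hxU
  obtain ⟨ρ, hρ⟩ := hcone.exists_kernel
  obtain ⟨C, -, h⟩ := exists_continuousOn_hasFDerivAt (F := F) hq hUo hUfin hρ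
  obtain ⟨g, -, hg, hd, -⟩ := h f hf hfc
  have hxV : x ∈ closure U ∩ Metric.ball x r :=
    ⟨subset_closure hxU, Metric.mem_ball_self hcone.r_pos⟩
  have := tendsto_nhds_unique (hx ρ hρ.contDiff.continuous hρ.hasCompactSupport hρ.integral_eq_one
    _ hρ.pos (hρ.mem x hxV)) (hg.tendsto_at hxV)
  rw [this]
  exact hd x ⟨hxU, hxV.2⟩

lemma HasInwardCone.mono {U : Set E3} {x₀ e : E3} {δ t₀ r r' : ℝ}
    (h : HasInwardCone U x₀ e δ t₀ r) (h0 : 0 < r') (hr : r' ≤ r) :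
    HasInwardCone U x₀ e δ t₀ r' :=
  ⟨h.δ_pos, h.t_pos, h0, fun x hx => h.subset x ⟨hx.1, Metric.ball_subset_ball hr hx.2⟩⟩

/-- Near a point with an inward cone, a bound for the derivative is a Lipschitz bound up to a factor:
two points are joined inside `U` by moving both along `e` by the multiple `‖a - b‖ / δ`, after which
the segment between them lies in the cone. -/
lemma HasInwardCone.exists_lipschitz {U : Set E3} {x₀ e : E3} {δ t₀ r : ℝ}
    (h : HasInwardCone U x₀ e δ t₀ r) :
    ∃ r' > 0, ∀ (f : E3 → F) (f' : E3 → E3 →L[ℝ] F) (ε : ℝ), ContinuousOn f (closure U) →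
      (∀ x ∈ U ∩ Metric.ball x₀ r, HasFDerivAt f (f' x) x) →
      (∀ x ∈ U ∩ Metric.ball x₀ r, ‖f' x‖ ≤ ε) →
      ∀ a ∈ closure U ∩ Metric.ball x₀ r', ∀ b ∈ closure U ∩ Metric.ball x₀ r',
        ‖f a - f b‖ ≤ (2 * ‖e‖ / δ + 1) * ε * ‖a - b‖ := by
  have hδ := h.δ_pos
  have ht₀ := h.t_pos
  have hr := h.r_pos
  -- the first bound keeps the detour below the height of the cone, the second keeps it in the ball
  set r' := min (δ * t₀ / 2) (r / (3 + 2 * ‖e‖ / δ)) with hr'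
  have hr'0 : 0 < r' := by positivity
  have hr'1 : r' ≤ δ * t₀ / 2 := min_le_left _ _
  have hr'2 : r' * (3 + 2 * ‖e‖ / δ) ≤ r :=
    (le_div_iff₀ (by positivity)).1 (min_le_right _ _)
  refine ⟨r', hr'0, fun f f' ε hf hd hb => ?_⟩
  have hseg : ∀ a b, segment ℝ a b ⊆ U ∩ Metric.ball x₀ r → ‖f b - f a‖ ≤ ε * ‖b - a‖ :=
    fun a b hab => Convex.norm_image_sub_le_of_norm_hasFDerivWithin_le
      (fun x hx => (hd x (hab hx)).hasFDerivWithinAt) (fun x hx => hb x (hab hx))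
      (convex_segment a b) (left_mem_segment ℝ a b) (right_mem_segment ℝ a b)
  have hU : ∀ a ∈ U ∩ Metric.ball x₀ r', ∀ b ∈ U ∩ Metric.ball x₀ r',
      ‖f a - f b‖ ≤ (2 * ‖e‖ / δ + 1) * ε * ‖a - b‖ := by
    intro a ha b hb
    rcases eq_or_ne a b with rfl | hab
    · simp
    set d := ‖a - b‖ with hd
    have hd0 : 0 < d := norm_pos_iff.2 (sub_ne_zero.2 hab)
    have ha2 : ‖a - x₀‖ < r' := mem_ball_iff_norm.1 ha.2
    have hb2 : ‖b - x₀‖ < r' := mem_ball_iff_norm.1 hb.2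
    have hd2 : d < 2 * r' := by
      have : a - b = (a - x₀) - (b - x₀) := by abel
      rw [hd, this]
      exact (norm_sub_le _ _).trans_lt (by linarith)
    set t := d / δ with ht
    have ht0 : 0 < t := by positivity
    have htt : t ≤ t₀ := by
      rw [ht, div_le_iff₀ hδ]; linarith
    have htδ : t * δ = d := div_mul_cancel₀ _ hδ.ne'
    have hte : t * ‖e‖ ≤ 2 * r' * (‖e‖ / δ) := by
      rw [ht, div_mul_eq_mul_div, ← mul_div_assoc]
      gcongr
    have hrr' : r' + 2 * r' * (‖e‖ / δ) + 2 * r' ≤ r := by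
      refine le_trans (le_of_eq ?_) hr'2
      ring
    have hr'r : r' ≤ r := by
      have : 0 ≤ 2 * r' * (‖e‖ / δ) := by positivity
      linarith
    have hvert : ∀ c ∈ U ∩ Metric.ball x₀ r', segment ℝ c (c + t • e) ⊆ U ∩ Metric.ball x₀ r := by
      intro c hc y hy
      rw [segment_eq_image'] at hy
      obtain ⟨θ, hθ, rfl⟩ := hy
      have hc2 : ‖c - x₀‖ < r' := mem_ball_iff_norm.1 hc.2
      simp only [add_sub_cancel_left, smul_smul]
      constructor
      · rcases hθ.1.eq_or_lt with h0 | h0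
        · rw [← h0]; simpa using hc.1
        · refine h.subset c ⟨subset_closure hc.1, Metric.ball_subset_ball hr'r hc.2⟩ (θ * t)
            (by positivity) ?_ (Metric.mem_closedBall_self (by positivity))
          exact (mul_le_of_le_one_left ht0.le hθ.2).trans htt
      · rw [mem_ball_iff_norm]
        have h3 : ‖(θ * t) • e‖ ≤ t * ‖e‖ := by
          rw [norm_smul, Real.norm_eq_abs, abs_of_nonneg (mul_nonneg hθ.1 ht0.le)]
          gcongr
          exact mul_le_of_le_one_left ht0.le hθ.2
        calc ‖c + (θ * t) • e - x₀‖ = ‖(c - x₀) + (θ * t) • e‖ := by congr 1; abel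
          _ ≤ ‖c - x₀‖ + ‖(θ * t) • e‖ := norm_add_le _ _
          _ < r := by linarith
    have hhor : segment ℝ (a + t • e) (b + t • e) ⊆ U ∩ Metric.ball x₀ r := by
      intro y hy
      rw [segment_eq_image'] at hy
      obtain ⟨θ, hθ, rfl⟩ := hy
      have h4 : ‖θ • (b + t • e - (a + t • e))‖ ≤ d := by
        rw [show b + t • e - (a + t • e) = b - a by abel, norm_smul, Real.norm_eq_abs,
          abs_of_nonneg hθ.1, norm_sub_rev, ← hd]
        exact mul_le_of_le_one_left hd0.le hθ.2
      constructor
      · refine h.subset a ⟨subset_closure ha.1, Metric.ball_subset_ball hr'r ha.2⟩ t ht0 htt ?_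
        rw [mem_closedBall_iff_norm, add_sub_cancel_left, htδ]
        exact h4
      · rw [mem_ball_iff_norm]
        have h3 : ‖t • e‖ = t * ‖e‖ := by
          rw [norm_smul, Real.norm_eq_abs, abs_of_pos ht0]
        calc _ = ‖(a - x₀) + t • e + θ • (b + t • e - (a + t • e))‖ := by congr 1; module
          _ ≤ ‖a - x₀‖ + ‖t • e‖ + ‖θ • (b + t • e - (a + t • e))‖ := norm_add₃_le
          _ < r := by linarith
    have k1 := hseg _ _ (hvert a ha)
    have k2 := hseg _ _ hhor
    have k3 := hseg _ _ (hvert b hb)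
    rw [add_sub_cancel_left, norm_smul, Real.norm_eq_abs, abs_of_pos ht0] at k1 k3
    rw [show b + t • e - (a + t • e) = b - a by abel, norm_sub_rev b a, ← hd] at k2
    calc ‖f a - f b‖ = ‖-(f (a + t • e) - f a) + -(f (b + t • e) - f (a + t • e)) +
          (f (b + t • e) - f b)‖ := by congr 1; abel
      _ ≤ ‖f (a + t • e) - f a‖ + ‖f (b + t • e) - f (a + t • e)‖ + ‖f (b + t • e) - f b‖ := by
          refine norm_add₃_le.trans ?_
          rw [norm_neg, norm_neg]
      _ ≤ ε * (t * ‖e‖) + ε * d + ε * (t * ‖e‖) := by gcongr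
      _ = _ := by rw [ht]; ring
  intro a ha b hb
  have hcl : ∀ c ∈ closure U ∩ Metric.ball x₀ r', (𝓝[U ∩ Metric.ball x₀ r'] c).NeBot := by
    intro c hc
    rw [← mem_closure_iff_nhdsWithin_neBot]
    exact Metric.isOpen_ball.closure_inter hc
  have hlim : ∀ c ∈ closure U ∩ Metric.ball x₀ r', Tendsto f (𝓝[U ∩ Metric.ball x₀ r'] c)
      (𝓝 (f c)) := fun c hc =>
    (hf c hc.1).mono (inter_subset_left.trans subset_closure)
  have hid : ∀ c : E3, Tendsto (fun y => y) (𝓝[U ∩ Metric.ball x₀ r'] c) (𝓝 c) := fun c =>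
    tendsto_id.mono_left nhdsWithin_le_nhds
  have := hcl a ha
  have := hcl b hb
  have step : ∀ a' ∈ U ∩ Metric.ball x₀ r', ‖f a' - f b‖ ≤ (2 * ‖e‖ / δ + 1) * ε * ‖a' - b‖ := by
    intro a' ha'
    refine le_of_tendsto_of_tendsto (tendsto_const_nhds.sub (hlim b hb)).norm
      ((tendsto_const_nhds.sub (hid b)).norm.const_mul _) ?_
    filter_upwards [self_mem_nhdsWithin] with b' hb'
    exact hU a' ha' b' hb'
  refine le_of_tendsto_of_tendsto ((hlim a ha).sub tendsto_const_nhds).norm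
      (((hid a).sub tendsto_const_nhds).norm.const_mul _) ?_
  filter_upwards [self_mem_nhdsWithin] with a' ha'
  exact step a' ha'

/-- A function that is `C¹` up to the boundary is strictly differentiable relative to the closure. -/
lemma HasInwardCone.hasFDerivAtFilter {U : Set E3} {x₀ e : E3} {δ t₀ r : ℝ}
    (h : HasInwardCone U x₀ e δ t₀ r) {f : E3 → F} {g : E3 → E3 →L[ℝ] F}
    (hf : ContinuousOn f (closure U))
    (hd : ∀ x ∈ U ∩ Metric.ball x₀ r, HasFDerivAt f (g x) x)
    (hg : Tendsto g (𝓝[U] x₀) (𝓝 (g x₀))) :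
    HasFDerivAtFilter f (g x₀) (𝓝[closure U] x₀ ×ˢ 𝓝[closure U] x₀) := by
  refine .of_isLittleO (Asymptotics.isLittleO_iff.2 fun ε hε => ?_)
  have hδ := h.δ_pos
  set K := 2 * ‖e‖ / δ + 1 with hK
  have hK0 : 0 < K := by positivity
  have h1 := Metric.tendsto_nhds.1 hg (ε / K) (by positivity)
  rw [eventually_nhdsWithin_iff, Metric.eventually_nhds_iff] at h1
  obtain ⟨r₁, hr₁, h1⟩ := h1
  have hr := h.r_pos
  have h2 := h.mono (r' := min r r₁) (by positivity) (min_le_left _ _)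
  obtain ⟨r', hr', h3⟩ := h2.exists_lipschitz (F := F)
  have h4 := h3 (fun x => f x - g x₀ x) (fun x => g x - g x₀) (ε / K)
    (hf.sub (g x₀).continuous.continuousOn)
    (fun x hx => (hd x ⟨hx.1, Metric.ball_subset_ball (min_le_left _ _) hx.2⟩).sub
      (g x₀).hasFDerivAt)
    (fun x hx => by
      rw [← dist_eq_norm]
      exact (h1 (Metric.ball_subset_ball (min_le_right _ _) hx.2) hx.1).le)
  have hm : closure U ∩ Metric.ball x₀ r' ∈ 𝓝[closure U] x₀ :=
    inter_mem self_mem_nhdsWithin (mem_nhdsWithin_of_mem_nhds (Metric.ball_mem_nhds _ hr'))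
  filter_upwards [prod_mem_prod hm hm] with p hp
  have h5 := h4 p.1 hp.1 p.2 hp.2
  rw [← hK, mul_div_cancel₀ _ hK0.ne'] at h5
  rwa [map_sub, show f p.1 - f p.2 - (g x₀ p.1 - g x₀ p.2) =
    f p.1 - g x₀ p.1 - (f p.2 - g x₀ p.2) by abel]

end Averages

/-! ### The space `W^{2,q}` and its local bounds -/

section WeakDerivative

variable {F : Type*} [NormedAddCommGroup F] [NormedSpace ℝ F]

lemma integrableOn_smul_of_tsupport_subset {U : Set E3} {g : E3 → F} (hg : LocallyIntegrableOn g U)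
    {k : E3 → ℝ} (hk : Continuous k) (hc : HasCompactSupport k) (hU : tsupport k ⊆ U) :
    IntegrableOn (fun y => k y • g y) U := by
  obtain ⟨A, -, hA⟩ := exists_bound_of_compactSupport hk hc
  have h1 : IntegrableOn g (tsupport k) := hg.integrableOn_compact_subset hU hc
  have h2 : IntegrableOn (fun y => k y • g y) (tsupport k) := integrable_bdd_smul h1 hk hA
  refine ((integrableOn_iff_integrable_of_support_subset fun y hy => ?_).1 h2).integrableOn
  refine subset_tsupport _ fun h => hy ?_
  simp [h]

lemma HasWeakFDeriv.sub {U : Set E3} {f₁ f₂ : E3 → F} {g₁ g₂ : E3 → E3 →L[ℝ] F}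
    (h₁ : HasWeakFDeriv U f₁ g₁) (h₂ : HasWeakFDeriv U f₂ g₂) :
    HasWeakFDeriv U (fun x => f₁ x - f₂ x) (fun x => g₁ x - g₂ x) := by
  refine ⟨h₁.1.sub h₂.1, h₁.2.sub h₂.2, fun φ hφ hc hU v => ?_⟩
  have hd : Continuous fun x => fderiv ℝ φ x v :=
    (hφ.continuous_fderiv (by simp)).clm_apply continuous_const
  have hdc : HasCompactSupport fun x => fderiv ℝ φ x v := hc.fderiv_apply (𝕜 := ℝ) v
  have hdU : tsupport (fun x => fderiv ℝ φ x v) ⊆ U :=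
    (tsupport_fderiv_apply_subset ℝ v).trans hU
  have happ : ∀ g : E3 → E3 →L[ℝ] F, LocallyIntegrableOn g U →
      IntegrableOn (fun x => φ x • g x v) U := fun g hg =>
    (ContinuousLinearMap.apply ℝ F v).integrable_comp
      (integrableOn_smul_of_tsupport_subset hg hφ.continuous hc hU)
  simp only [smul_sub, _root_.sub_apply]
  rw [integral_sub (integrableOn_smul_of_tsupport_subset h₁.1 hd hdc hdU)
    (integrableOn_smul_of_tsupport_subset h₂.1 hd hdc hdU),
    integral_sub (happ _ h₁.2) (happ _ h₂.2), h₁.3 φ hφ hc hU v, h₂.3 φ hφ hc hU v]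
  abel

lemma HasWeakFDeriv.ae_eq [CompleteSpace F] {U : Set E3} (hUo : IsOpen U) {f : E3 → F}
    {g₁ g₂ : E3 → E3 →L[ℝ] F} (h₁ : HasWeakFDeriv U f g₁) (h₂ : HasWeakFDeriv U f g₂) :
    g₁ =ᵐ[volume.restrict U] g₂ := by
  have key := hUo.ae_eq_zero_of_integral_contDiff_smul_eq_zero (μ := volume)
    (f := fun x => g₁ x - g₂ x) (h₁.2.sub h₂.2) ?_
  · rw [EventuallyEq, ae_restrict_iff' hUo.measurableSet]
    filter_upwards [key] with x hx hxU using sub_eq_zero.1 (hx hxU)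
  · intro φ hφ hc hU
    have i1 := integrableOn_smul_of_tsupport_subset h₁.2 hφ.continuous hc hU
    have i2 := integrableOn_smul_of_tsupport_subset h₂.2 hφ.continuous hc hU
    rw [← setIntegral_eq_integral_of_forall_compl_eq_zero (s := U)]
    · simp only [smul_sub]
      rw [integral_sub i1 i2, sub_eq_zero]
      ext v
      rw [ContinuousLinearMap.integral_apply i1, ContinuousLinearMap.integral_apply i2]
      have e1 := h₁.3 φ hφ hc hU v
      have e2 := h₂.3 φ hφ hc hU v
      simp only [_root_.smul_apply]
      exact neg_injective (e1.symm.trans e2)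
    · intro x hx
      rw [image_eq_zero_of_notMem_tsupport fun h => hx (hU h), zero_smul]

lemma HasWeakFDeriv.congr_ae {U : Set E3} {f f' : E3 → F}
    {g : E3 → E3 →L[ℝ] F} (h : HasWeakFDeriv U f g) (hff : f' =ᵐ[volume.restrict U] f)
    (hf' : IntegrableOn f' U) : HasWeakFDeriv U f' g := by
  refine ⟨hf'.locallyIntegrableOn, h.2, fun φ hφ hc hU v => ?_⟩
  rw [← h.3 φ hφ hc hU v]
  refine integral_congr_ae ?_
  filter_upwards [hff] with x hx
  rw [hx]

/-- The chosen weak derivative of a difference is only a.e. the difference of the chosen weak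
derivatives, which is why uniqueness enters. -/
lemma MemW2.sub [CompleteSpace F] {q : ℝ} (hq : 3 < q) {U : Set E3} (hUo : IsOpen U)
    (hUfin : volume U ≠ ⊤) {f₁ f₂ : E3 → F} (h₁ : MemW2 q U f₁) (h₂ : MemW2 q U f₂) :
    MemW2 q U (fun x => f₁ x - f₂ x) := by
  have : IsFiniteMeasure (volume.restrict U) := ⟨by simpa using hUfin.lt_top⟩
  have hq1 : (1 : ℝ≥0∞) ≤ ENNReal.ofReal q := by rw [ENNReal.one_le_ofReal]; linarith
  have hw := (hasWeakFDeriv_weakFDeriv h₁.1).sub (hasWeakFDeriv_weakFDeriv h₂.1)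
  have e1 := (hasWeakFDeriv_weakFDeriv ⟨_, hw⟩).ae_eq hUo hw
  have m1 : MemLp (weakFDeriv U fun x => f₁ x - f₂ x) (ENNReal.ofReal q) (volume.restrict U) :=
    (memLp_congr_ae e1).2 (h₁.memLp_one.sub h₂.memLp_one)
  have hw2 := ((hasWeakFDeriv_weakFDeriv h₁.2).sub (hasWeakFDeriv_weakFDeriv h₂.2)).congr_ae e1
    (m1.integrable hq1)
  have e2 := (hasWeakFDeriv_weakFDeriv ⟨_, hw2⟩).ae_eq hUo hw2
  exact ⟨⟨_, hw⟩, ⟨_, hw2⟩, h₁.memLp.sub h₂.memLp, m1,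
    (memLp_congr_ae e2).2 (h₁.memLp_two.sub h₂.memLp_two)⟩

/-- The local sup and Lipschitz seminorms up to the boundary are controlled by the `W^{2,q}` norm. -/
lemma HasInwardCone.exists_norm_sub_le [CompleteSpace F] {q : ℝ} (hq : 3 < q) {U : Set E3}
    (hUo : IsOpen U) (hUfin : volume U ≠ ⊤) {x₀ e : E3} {δ t₀ r : ℝ}
    (h : HasInwardCone U x₀ e δ t₀ r) :
    ∃ r' > 0, ∃ C, 0 ≤ C ∧ ∀ f : E3 → F, MemW2 q U f → ContinuousOn f (closure U) →
      ∀ a ∈ closure U ∩ Metric.ball x₀ r', ‖f a‖ ≤ C * (normW2 q U f).toReal ∧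
        ∀ b ∈ closure U ∩ Metric.ball x₀ r', ‖f a - f b‖ ≤ C * (normW2 q U f).toReal * ‖a - b‖ := by
  obtain ⟨ρ, hρ⟩ := h.exists_kernel
  obtain ⟨C, hC, h1⟩ := exists_continuousOn_hasFDerivAt (F := F) hq hUo hUfin hρ
  obtain ⟨r', hr', h2⟩ := h.exists_lipschitz (F := F)
  have hδ := h.δ_pos
  refine ⟨min r r', lt_min h.r_pos hr', max C ((2 * ‖e‖ / δ + 1) * C), by positivity,
    fun f hf hfc a ha => ?_⟩
  obtain ⟨g, -, -, hd, hb⟩ := h1 f hf hfc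
  have hN : 0 ≤ (normW2 q U f).toReal := ENNReal.toReal_nonneg
  constructor
  · refine (hb a ⟨ha.1, Metric.ball_subset_ball (min_le_left _ _) ha.2⟩).1.trans ?_
    gcongr
    exact le_max_left _ _
  · intro b hb'
    refine (h2 f g (C * (normW2 q U f).toReal) hfc hd
      (fun x hx => (hb x ⟨subset_closure hx.1, hx.2⟩).2)
      a ⟨ha.1, Metric.ball_subset_ball (min_le_right _ _) ha.2⟩
      b ⟨hb'.1, Metric.ball_subset_ball (min_le_right _ _) hb'.2⟩).trans ?_
    rw [← mul_assoc]
    gcongr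
    exact le_max_right _ _

end WeakDerivative

/-! ### Geometry of `C¹` boundaries -/

lemma tendsto_add_smul_nhdsGT (p v : E3) :
    Tendsto (fun t : ℝ => p + t • v) (𝓝[>] 0) (𝓝 p) := by
  have h : Continuous fun t : ℝ => p + t • v := by fun_prop
  simpa using (h.tendsto 0).mono_left nhdsWithin_le_nhds

lemma tendsto_sub_smul_nhdsGT (p v : E3) :
    Tendsto (fun t : ℝ => p - t • v) (𝓝[>] 0) (𝓝 p) := by
  simpa [sub_eq_add_neg] using tendsto_add_smul_nhdsGT p (-v)

/-- Near `p`, `U` is the set where the `C¹` function `φ` is positive, and `φ` grows with unit speed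
along `e`; this is the graph description of a `C¹` boundary without coordinates. -/
structure IsLocalGraph (U : Set E3) (p : E3) (φ : E3 → ℝ) (e : E3) (r : ℝ) : Prop where
  r_pos : 0 < r
  contDiff : ContDiff ℝ 1 φ
  shift : ∀ x t, φ (x + t • e) = φ x + t
  mem_iff : ∀ x ∈ Metric.ball p r, (x ∈ U ↔ 0 < φ x)

lemma IsC1Holder.exists_isLocalGraph {α : ℝ≥0} {U : Set E3} (h : IsC1Holder α U) {p : E3}
    (hp : p ∈ frontier U) : ∃ φ e r, IsLocalGraph U p φ e r := by
  obtain ⟨r, hr, b, γ, K, hγ, -, hmem⟩ := h p hp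
  have hco : ∀ i : Fin 3, ContDiff ℝ 1 fun x : E3 => b.repr x i := fun i =>
    contDiff_euclidean.1 b.repr.toContinuousLinearEquiv.contDiff i
  have h2 : ContDiff ℝ 1 fun x : E3 => (!₂[b.repr x 0, b.repr x 1] : EuclideanSpace ℝ (Fin 2)) := by
    refine contDiff_euclidean.2 fun i => ?_
    fin_cases i
    · exact hco 0
    · exact hco 1
  refine ⟨fun x => b.repr x 2 - γ (!₂[b.repr x 0, b.repr x 1]), b 2, r, hr,
    (hco 2).sub (hγ.comp h2), fun x t => ?_, fun x hx => by rw [hmem x hx, sub_pos]⟩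
  simp [map_add]
  ring

namespace IsLocalGraph

variable {U : Set E3} {p e : E3} {φ : E3 → ℝ} {r : ℝ}

lemma mem_closure_iff (h : IsLocalGraph U p φ e r) {x : E3} (hx : x ∈ Metric.ball p r) :
    x ∈ closure U ↔ 0 ≤ φ x := by
  constructor
  · intro hxU
    have h1 : x ∈ closure (U ∩ Metric.ball p r) := Metric.isOpen_ball.closure_inter ⟨hxU, hx⟩
    have h2 : IsClosed {x | 0 ≤ φ x} := isClosed_le continuous_const h.contDiff.continuous
    exact closure_minimal (fun y hy => ((h.mem_iff y hy.2).1 hy.1).le) h2 h1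
  · intro h0
    have h1 := tendsto_add_smul_nhdsGT x e
    refine mem_closure_of_tendsto h1 ?_
    filter_upwards [h1.eventually (Metric.isOpen_ball.mem_nhds hx), self_mem_nhdsWithin] with t ht ht0
    rw [h.mem_iff _ ht, h.shift]
    have : (0:ℝ) < t := ht0
    linarith

lemma mem_frontier_iff (h : IsLocalGraph U p φ e r) (hU : IsOpen U) {x : E3}
    (hx : x ∈ Metric.ball p r) : x ∈ frontier U ↔ φ x = 0 := by
  rw [hU.frontier_eq, Set.mem_sdiff, h.mem_closure_iff hx, h.mem_iff x hx, not_lt, le_antisymm_iff,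
    and_comm]

lemma fderiv_apply_self (h : IsLocalGraph U p φ e r) (x : E3) : fderiv ℝ φ x e = 1 := by
  have h1 : HasDerivAt (fun t : ℝ => x + t • e) e 0 := by
    simpa using ((hasDerivAt_id (0:ℝ)).smul_const e).const_add x
  have h2 : HasFDerivAt φ (fderiv ℝ φ x) (x + (0:ℝ) • e) := by
    simpa using ((h.contDiff.differentiable (by simp)) x).hasFDerivAt
  have h3 := h2.comp_hasDerivAt (0:ℝ) h1
  have h4 : HasDerivAt (fun t : ℝ => φ x + t) 1 0 := (hasDerivAt_id (0:ℝ)).const_add _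
  exact h3.unique (h4.congr_of_eventuallyEq (Eventually.of_forall fun t => h.shift x t))

lemma exists_hasInwardCone (h : IsLocalGraph U p φ e r) {w : E3} (hw : 0 < fderiv ℝ φ p w) :
    ∃ δ t₀ r', HasInwardCone U p w δ t₀ r' := by
  set ℓ := fderiv ℝ φ p with hℓ
  have hs : HasStrictFDerivAt φ ℓ p := h.contDiff.contDiffAt.hasStrictFDerivAt (by simp)
  set c := ℓ w / (4 * (‖w‖ + 1)) with hc
  have hc0 : 0 < c := by positivity
  obtain ⟨m, hm0, hm⟩ := Metric.eventually_nhds_iff.1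
    ((Asymptotics.isLittleO_iff.1 hs.isLittleO) hc0)
  set δ := min 1 (ℓ w / (4 * (‖ℓ‖ + 1))) with hδ
  have hδ0 : 0 < δ := by positivity
  set d := min m r with hd
  have hr := h.r_pos
  have hd0 : 0 < d := lt_min hm0 hr
  refine ⟨δ, d / (4 * (‖w‖ + 1)), d / 2, hδ0, by positivity, by positivity, ?_⟩
  intro x hx t ht htd y hy
  have hx2 : ‖x - p‖ < d / 2 := mem_ball_iff_norm.1 hx.2
  set z := y - (x + t • w) with hz
  have hz1 : ‖z‖ ≤ t * δ := mem_closedBall_iff_norm.1 hy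
  have hyx : y - x = t • w + z := by rw [hz]; abel
  have hδ1 : δ ≤ 1 := min_le_left _ _
  have hδ2 : δ * (4 * (‖ℓ‖ + 1)) ≤ ℓ w := (le_div_iff₀ (by positivity)).1 (min_le_right _ _)
  have hyx2 : ‖y - x‖ ≤ t * (‖w‖ + 1) := by
    rw [hyx]
    refine (norm_add_le _ _).trans ?_
    rw [norm_smul, Real.norm_eq_abs, abs_of_pos ht, mul_add]
    gcongr
    refine hz1.trans ?_
    gcongr
  have htd2 : t * (‖w‖ + 1) ≤ d / 4 := by
    have := (le_div_iff₀ (by positivity)).1 htd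
    linarith
  have hy2 : ‖y - p‖ < d := by
    have : y - p = (y - x) + (x - p) := by abel
    rw [this]
    refine (norm_add_le _ _).trans_lt ?_
    linarith
  have hyr : y ∈ Metric.ball p r := mem_ball_iff_norm.2 (hy2.trans_le (min_le_right _ _))
  have hxr : x ∈ Metric.ball p r :=
    mem_ball_iff_norm.2 (hx2.trans ((half_lt_self hd0).trans_le (min_le_right _ _)))
  rw [h.mem_iff y hyr]
  have h0 : 0 ≤ φ x := (h.mem_closure_iff hxr).1 hx.1
  have hest := hm (y := (y, x)) (by
    rw [dist_eq_norm, Prod.norm_def, max_lt_iff]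
    exact ⟨hy2.trans_le (min_le_left _ _), hx2.trans ((half_lt_self hd0).trans_le (min_le_left _ _))⟩)
  simp only at hest
  have h1 := (abs_le.1 hest).1
  have h2 : -(‖ℓ‖ * (t * δ)) ≤ ℓ z := by
    have := (ℓ.le_opNorm z).trans (mul_le_mul_of_nonneg_left hz1 (norm_nonneg _))
    exact (abs_le.1 this).1
  have h3 : ℓ (y - x) = t * ℓ w + ℓ z := by rw [hyx, map_add, map_smul, smul_eq_mul]
  have h4 : c * ‖y - x‖ ≤ t * (ℓ w / 4) := by
    calc c * ‖y - x‖ ≤ c * (t * (‖w‖ + 1)) := by gcongr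
      _ = _ := by rw [hc]; field_simp
  have h5 : ‖ℓ‖ * (t * δ) ≤ t * (ℓ w / 4) := by
    have : ‖ℓ‖ * δ ≤ ℓ w / 4 := by nlinarith
    nlinarith
  have h6 : 0 < t * ℓ w := mul_pos ht hw
  linarith

end IsLocalGraph

lemma IsC1HolderDomain.exists_hasInwardCone {α : ℝ≥0} {U : Set E3} (h : IsC1HolderDomain α U)
    {x : E3} (hx : x ∈ closure U) : ∃ e δ t₀ r, HasInwardCone U x e δ t₀ r := by
  by_cases hxU : x ∈ U
  · exact exists_hasInwardCone_of_mem h.isOpen hxU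
  · obtain ⟨φ, e, r, hg⟩ := h.isC1Holder.exists_isLocalGraph
      (show x ∈ frontier U by rw [h.isOpen.frontier_eq]; exact ⟨hx, hxU⟩)
    exact ⟨e, hg.exists_hasInwardCone (by rw [hg.fderiv_apply_self]; exact one_pos)⟩

lemma IsC1HolderDomain.interior_closure {α : ℝ≥0} {U : Set E3} (h : IsC1HolderDomain α U) :
    interior (closure U) = U := by
  refine Subset.antisymm (fun p hp => ?_) (interior_maximal subset_closure h.isOpen)
  by_contra hpU
  obtain ⟨e, δ, t₀, r, hc⟩ := h.exists_hasInwardCone (interior_subset hp)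
  have h1 := tendsto_sub_smul_nhdsGT p e
  obtain ⟨t, ⟨ht1, ht2⟩, ht3⟩ := ((h1.eventually (mem_interior_iff_mem_nhds.1 hp)).and
    (h1.eventually (Metric.ball_mem_nhds p hc.r_pos)) |>.and (Ioc_mem_nhdsGT hc.t_pos)).exists
  apply hpU
  have hδ := hc.δ_pos
  have := hc.subset (p - t • e) ⟨ht1, ht2⟩ t ht3.1 ht3.2
    (Metric.mem_closedBall_self (mul_nonneg ht3.1.le hδ.le))
  simpa using this

/-! ### Deformations are injective immersions up to the boundary -/

/-- `η` is an injective immersion of `U`, strictly differentiable with invertible derivative relative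
to `closure U` at each point of `closure U`. Self-contact at the boundary is allowed. -/
structure IsRegularEmbedding (U : Set E3) (η : E3 → E3) : Prop where
  continuousOn : ContinuousOn η (closure U)
  injOn : InjOn η U
  exists_equiv : ∀ x ∈ closure U, ∃ L : E3 ≃L[ℝ] E3,
    HasFDerivAtFilter η (L : E3 →L[ℝ] E3) (𝓝[closure U] x ×ˢ 𝓝[closure U] x)

lemma hasStrictFDerivAt_of_mem {U : Set E3} (hU : IsOpen U) {η : E3 → E3} {L : E3 →L[ℝ] E3} {x : E3}
    (hx : x ∈ U) (h : HasFDerivAtFilter η L (𝓝[closure U] x ×ˢ 𝓝[closure U] x)) :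
    HasStrictFDerivAt η L x := by
  rw [nhdsWithin_eq_nhds.2 (mem_of_superset (hU.mem_nhds hx) subset_closure), ← nhds_prod_eq] at h
  exact h

/-- Injectivity comes from the Ciarlet–Nečas condition: if `η x = η y` with `x ≠ y`, some ball around
`x` can be removed from `U` without changing the image, so that the volume of the image is strictly
less than the integral of the determinant. -/
lemma IsDeformation.isRegularEmbedding {α : ℝ≥0} {q : ℝ} (hq : 3 < q) {Ω U : Set E3}
    (hU : IsC1HolderDomain α U) {η : E3 → E3} (hη : IsDeformation q Ω U η) :
    IsRegularEmbedding U η := by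
  have hUo := hU.isOpen
  have hUfin : volume U ≠ ⊤ := hU.isBounded.measure_lt_top.ne
  obtain ⟨c, hc0, hc⟩ := hη.det_pos
  have hae := ae_hasFDerivAt_weakFDeriv hq hUo hUfin hη.memW2 hη.continuousOn
  have hstrict : ∀ x ∈ closure U, ∃ L : E3 ≃L[ℝ] E3,
      HasFDerivAtFilter η (L : E3 →L[ℝ] E3) (𝓝[closure U] x ×ˢ 𝓝[closure U] x) := by
    intro x hx
    obtain ⟨e, δ, t₀, r, hcone⟩ := hU.exists_hasInwardCone hx
    obtain ⟨ρ, hρ⟩ := hcone.exists_kernel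
    obtain ⟨C, -, h⟩ := exists_continuousOn_hasFDerivAt (F := E3) hq hUo hUfin hρ
    obtain ⟨g, hgc, -, hd, -⟩ := h η hη.memW2 hη.continuousOn
    have hball : Metric.ball x r ∈ 𝓝 x := Metric.ball_mem_nhds x hcone.r_pos
    have hg : Tendsto g (𝓝[U] x) (𝓝 (g x)) := by
      have h1 := hgc x ⟨hx, Metric.mem_ball_self hcone.r_pos⟩
      rw [ContinuousWithinAt, nhdsWithin_inter_of_mem' (mem_nhdsWithin_of_mem_nhds hball)] at h1
      exact h1.mono_left (nhdsWithin_mono _ subset_closure)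
    -- the lower bound of the determinant holds everywhere by continuity
    have hdet : ∀ y ∈ U ∩ Metric.ball x r, c ≤ (g y).det := by
      intro y hy
      by_contra hlt
      push Not at hlt
      have hgy : ContinuousAt g y := by
        refine (hgc y ⟨subset_closure hy.1, hy.2⟩).continuousAt ?_
        exact mem_of_superset ((hUo.inter Metric.isOpen_ball).mem_nhds hy)
          (inter_subset_inter_left _ subset_closure)
      have hmem : ∀ᶠ z in 𝓝 y, z ∈ U ∩ Metric.ball x r :=
        (hUo.inter Metric.isOpen_ball).mem_nhds hy
      have hev : ∀ᶠ z in 𝓝 y, (z ∈ U ∩ Metric.ball x r) ∧ (g z).det < c :=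
        hmem.and
          ((ContinuousLinearMap.continuous_det.continuousAt.comp hgy).eventually_lt_const hlt)
      have hnull : volume {z | (z ∈ U ∩ Metric.ball x r) ∧ (g z).det < c} = 0 := by
        have h2 : ∀ᵐ z ∂volume, z ∈ U → c ≤ (fderiv ℝ η z).det := by
          rw [← ae_restrict_iff' hUo.measurableSet]
          filter_upwards [hc, hae] with z hz1 hz2
          rwa [hz2.fderiv]
        refine measure_mono_null (fun z hz => ?_) h2
        simp only [mem_ofPred_eq, mem_compl_iff, Classical.not_imp, not_le] at hz ⊢
        refine ⟨hz.1.1, ?_⟩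
        rw [(hd z hz.1).fderiv]
        exact hz.2
      exact (Measure.measure_pos_of_mem_nhds volume hev).ne' hnull
    have hdetx : c ≤ (g x).det := by
      have : (𝓝[U] x).NeBot := mem_closure_iff_nhdsWithin_neBot.1 hx
      refine ge_of_tendsto ((ContinuousLinearMap.continuous_det.tendsto (g x)).comp hg) ?_
      filter_upwards [self_mem_nhdsWithin, mem_nhdsWithin_of_mem_nhds hball] with y hy1 hy2
      exact hdet y ⟨hy1, hy2⟩
    refine ⟨(g x).toContinuousLinearEquivOfDetNeZero (hc0.trans_le hdetx).ne', ?_⟩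
    rw [ContinuousLinearMap.coe_toContinuousLinearEquivOfDetNeZero]
    exact hcone.hasFDerivAtFilter hη.continuousOn hd hg
  refine ⟨hη.continuousOn, fun x hx y hy hxy => ?_, hstrict⟩
  by_contra hne
  obtain ⟨A, B, hA, hB, hxA, hyB, hAB⟩ := t2_separation hne
  have hWy : η '' (B ∩ U) ∈ 𝓝 (η x) := by
    obtain ⟨L, hL⟩ := hstrict y (subset_closure hy)
    rw [hxy, ← (hasStrictFDerivAt_of_mem hUo hy hL).map_nhds_eq_of_equiv]
    exact image_mem_map (inter_mem (hB.mem_nhds hyB) (hUo.mem_nhds hy))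
  have hcx : ContinuousAt η x := (hη.continuousOn x (subset_closure hx)).continuousAt
    (mem_of_superset (hUo.mem_nhds hx) subset_closure)
  obtain ⟨r, hr, hrs⟩ := Metric.mem_nhds_iff.1
    (inter_mem (inter_mem (hA.mem_nhds hxA) (hUo.mem_nhds hx)) (hcx hWy))
  set P := Metric.ball x r with hP
  have hPU : P ⊆ U := fun z hz => (hrs hz).1.2
  have himg : η '' U = η '' (U \ P) := by
    refine Subset.antisymm ?_ (image_mono sdiff_subset)
    rintro _ ⟨z, hz, rfl⟩
    by_cases hzP : z ∈ P
    · obtain ⟨z', hz', hzz⟩ := (hrs hzP).2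
      refine ⟨z', ⟨hz'.2, fun h => ?_⟩, hzz⟩
      exact disjoint_left.1 hAB (hrs h).1.1 hz'.1
    · exact ⟨z, ⟨hz, hzP⟩, rfl⟩
  have hUP : MeasurableSet (U \ P) := hUo.measurableSet.diff Metric.isOpen_ball.measurableSet
  have h1 : volume (η '' U) ≤ ∫⁻ z in U \ P, ENNReal.ofReal (weakFDeriv U η z).det := by
    rw [himg]
    refine (addHaar_image_le_lintegral_abs_det_fderiv volume hUP (f' := fderiv ℝ η)
      fun z hz => ?_).trans (le_of_eq ?_)
    · obtain ⟨L, hL⟩ := hstrict z (subset_closure hz.1)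
      have hd := (hasStrictFDerivAt_of_mem hUo hz.1 hL).hasFDerivAt.differentiableAt
      exact hd.hasFDerivAt.hasFDerivWithinAt
    · refine lintegral_congr_ae ?_
      filter_upwards [ae_restrict_of_ae_restrict_of_subset sdiff_subset hae,
        ae_restrict_of_ae_restrict_of_subset sdiff_subset hc] with z hz1 hz2
      rw [hz1.fderiv, abs_of_nonneg (hc0.le.trans hz2)]
  have h2 : ENNReal.ofReal c * volume P ≤ ∫⁻ z in P, ENNReal.ofReal (weakFDeriv U η z).det := by
    rw [← setLIntegral_const]
    refine lintegral_mono_ae ?_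
    filter_upwards [ae_restrict_of_ae_restrict_of_subset hPU hc] with z hz
    exact ENNReal.ofReal_le_ofReal hz
  have h3 : volume (η '' U) = (∫⁻ z in P, ENNReal.ofReal (weakFDeriv U η z).det) +
      ∫⁻ z in U \ P, ENNReal.ofReal (weakFDeriv U η z).det := by
    rw [hη.ciarletNecas, ← lintegral_union hUP disjoint_sdiff_right, union_sdiff_cancel hPU]
  have hfin : volume (η '' U) ≠ ⊤ := by
    refine ((measure_mono (image_mono subset_closure)).trans_lt
      (IsCompact.measure_lt_top ?_ : volume (η '' closure U) < ⊤)).ne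
    exact hU.isBounded.isCompact_closure.image_of_continuousOn hη.continuousOn
  have h4 : volume (η '' U) + ENNReal.ofReal c * volume P ≤ volume (η '' U) := by
    conv_rhs => rw [h3, add_comm]
    exact add_le_add h1 h2
  have h5 : ENNReal.ofReal c * volume P = 0 := by
    by_contra h0
    exact absurd (ENNReal.lt_add_right hfin h0) (not_lt.2 h4)
  rcases mul_eq_zero.1 h5 with h6 | h6
  · exact absurd (ENNReal.ofReal_eq_zero.1 h6) (not_le.2 hc0)
  · exact (Metric.measure_ball_pos volume x hr).ne' h6

/-! ### Half-spaces of the image at boundary points -/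

lemma exists_approximatesLinearOn {D : Set E3} {η : E3 → E3} {L : E3 →L[ℝ] E3} {x : E3}
    (h : HasFDerivAtFilter η L (𝓝[D] x ×ˢ 𝓝[D] x)) {c : ℝ≥0} (hc : 0 < c) {W : Set E3}
    (hW : W ∈ 𝓝 x) :
    ∃ r > 0, Metric.ball x r ⊆ W ∧ ApproximatesLinearOn η L (D ∩ Metric.ball x r) c := by
  have h1 : {p : E3 × E3 | ‖η p.1 - η p.2 - L (p.1 - p.2)‖ ≤ c * ‖p.1 - p.2‖} ∈
      𝓝[D] x ×ˢ 𝓝[D] x := Asymptotics.isLittleO_iff.1 h.isLittleO (NNReal.coe_pos.2 hc)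
  obtain ⟨s, hs, hss⟩ := mem_prod_self_iff.1 h1
  obtain ⟨r, hr, hrs⟩ := Metric.mem_nhdsWithin_iff.1 (inter_mem hs (mem_nhdsWithin_of_mem_nhds hW))
  obtain ⟨r', hr', hrs'⟩ := Metric.mem_nhds_iff.1 hW
  refine ⟨min r r', lt_min hr hr', (Metric.ball_subset_ball (min_le_right _ _)).trans hrs',
    fun a ha b hb => ?_⟩
  have hmem : ∀ a ∈ D ∩ Metric.ball x (min r r'), a ∈ s := fun a ha =>
    (hrs ⟨Metric.ball_subset_ball (min_le_left _ _) ha.2, ha.1⟩).1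
  have h2 := hss (mk_mem_prod (hmem a ha) (hmem b hb))
  rwa [mem_ofPred_eq] at h2

lemma nnnorm_symm_pos_of_equiv (L : E3 ≃L[ℝ] E3) :
    0 < ‖(L.symm : E3 →L[ℝ] E3)‖₊ := by
  rcases L.subsingleton_or_nnnorm_symm_pos with h | h
  · exact absurd h (not_subsingleton E3)
  · exact h

/-- A direction `w` that points into `U` at `x` is mapped by the derivative to a direction that points
into the image, uniformly at the base points near `x`. This is the surjectivity half of the inverse
function theorem, applied on the balls of the cone around `w`. -/
lemma HasInwardCone.exists_add_smul_mem_image {U : Set E3} {η : E3 → E3} {x w : E3} {L : E3 ≃L[ℝ] E3}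
    (hL : HasFDerivAtFilter η (L : E3 →L[ℝ] E3) (𝓝[closure U] x ×ˢ 𝓝[closure U] x))
    {δ t₀ r : ℝ} (hc : HasInwardCone U x w δ t₀ r) {W : Set E3} (hW : W ∈ 𝓝 x) :
    ∃ V ∈ 𝓝 x, ∃ ε > 0, ∀ x' ∈ closure U ∩ V, ∀ t ∈ Ioo (0 : ℝ) ε,
      η x' + t • L w ∈ η '' (U ∩ W) := by
  have hδ := hc.δ_pos
  have hN := nnnorm_symm_pos_of_equiv L
  set N := ‖(L.symm : E3 →L[ℝ] E3)‖₊ with hNdef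
  have hNr : (0:ℝ) < N := NNReal.coe_pos.2 hN
  -- this choice of `c` makes `c ‖w‖ = (N⁻¹ - c) δ`
  obtain ⟨c, hc1⟩ : ∃ c : ℝ≥0, (c : ℝ) = (N : ℝ)⁻¹ * δ / (‖w‖ + δ) :=
    ⟨⟨(N : ℝ)⁻¹ * δ / (‖w‖ + δ), by positivity⟩, rfl⟩
  have hc0 : 0 < c := by
    rw [← NNReal.coe_pos, hc1]; positivity
  have hceq : (c : ℝ) * ‖w‖ = ((N : ℝ)⁻¹ - c) * δ := by
    rw [hc1]; field_simp; ring
  obtain ⟨s, hs, hsW, happ⟩ := exists_approximatesLinearOn hL hc0 hW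
  have hr := hc.r_pos
  have ht₀ := hc.t_pos
  refine ⟨Metric.ball x (min (s / 2) r), Metric.ball_mem_nhds x (by positivity),
    min t₀ (s / (2 * (‖w‖ + δ))), by positivity, fun x' hx' t ht => ?_⟩
  have hx's : x' ∈ Metric.ball x (s / 2) := Metric.ball_subset_ball (min_le_left _ _) hx'.2
  have hx'r : x' ∈ Metric.ball x r := Metric.ball_subset_ball (min_le_right _ _) hx'.2
  have ht1 : t ≤ t₀ := ht.2.le.trans (min_le_left _ _)
  have ht2 : t * (‖w‖ + δ) ≤ s / 2 := by
    have := (le_div_iff₀ (by positivity)).1 (ht.2.le.trans (min_le_right _ _))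
    linarith
  have ht0 : 0 < t := ht.1
  have hsub := hc.subset x' ⟨hx'.1, hx'r⟩ t ht0 ht1
  have hball : Metric.closedBall (x' + t • w) (t * δ) ⊆ Metric.ball x s := by
    intro y hy
    rw [mem_closedBall_iff_norm] at hy
    rw [mem_ball_iff_norm] at hx's ⊢
    calc ‖y - x‖ = ‖(y - (x' + t • w)) + t • w + (x' - x)‖ := by congr 1; abel
      _ ≤ ‖y - (x' + t • w)‖ + ‖t • w‖ + ‖x' - x‖ := norm_add₃_le
      _ < t * δ + t * ‖w‖ + s / 2 := by
        rw [norm_smul, Real.norm_eq_abs, abs_of_pos ht0]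
        linarith
      _ ≤ s := by linarith
  have hsurj := happ.surjOn_closedBall_of_nonlinearRightInverse L.toNonlinearRightInverse
    (ε := t * δ) (b := x' + t • w) (by positivity)
    fun y hy => ⟨subset_closure (hsub hy), hball hy⟩
  have hcen : x' + t • w ∈ Metric.closedBall (x' + t • w) (t * δ) :=
    Metric.mem_closedBall_self (by positivity)
  have hmem : η x' + t • L w ∈ Metric.closedBall (η (x' + t • w))
      ((((L.toNonlinearRightInverse).nnnorm : ℝ)⁻¹ - c) * (t * δ)) := by
    rw [mem_closedBall_iff_norm, norm_sub_rev]
    have h1 := happ (x' + t • w) ⟨subset_closure (hsub hcen), hball hcen⟩ x'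
      ⟨hx'.1, Metric.ball_subset_ball (by linarith) hx's⟩
    rw [add_sub_cancel_left, norm_smul, Real.norm_eq_abs, abs_of_pos ht0] at h1
    have h2 : η (x' + t • w) - (η x' + t • L w) =
        η (x' + t • w) - η x' - (L : E3 →L[ℝ] E3) (t • w) := by
      rw [map_smul, ContinuousLinearEquiv.coe_coe]; abel
    rw [h2]
    refine h1.trans (le_of_eq ?_)
    change _ = ((N : ℝ)⁻¹ - c) * (t * δ)
    linear_combination t * hceq
  obtain ⟨y, hy, hye⟩ := hsurj hmem
  exact ⟨y, ⟨hsub hy, hsW (hball hy)⟩, hye⟩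

/-- `m` is a conormal at `x` of the image of `U` under `η`: the directions of the open half-space
`{m > 0}` point into `η '' U` from the images of all points of `closure U` near `x`, and for one of
them, `v`, the short segments in the directions `± v` from the points of `η '' frontier U` near `η x`
cover a neighbourhood of `η x`. For `η = id` it is an inner conormal of `U` itself. -/
structure IsInnerConormal (U : Set E3) (η : E3 → E3) (x : E3) (m : E3 →L[ℝ] ℝ) : Prop where
  segment : ∀ v, 0 < m v → ∀ W ∈ 𝓝 x, ∃ V ∈ 𝓝 x, ∃ ε > 0, ∀ x' ∈ closure U ∩ V, ∀ t ∈ Ioo (0 : ℝ) ε,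
    η x' + t • v ∈ η '' (U ∩ W)
  collar : ∃ v, 0 < m v ∧ ∀ V ∈ 𝓝 x, ∀ ε > 0,
    {z | ∃ x' ∈ frontier U ∩ V, ∃ t : ℝ, |t| < ε ∧ z = η x' + t • v} ∈ 𝓝 (η x)

namespace IsRegularEmbedding

variable {α : ℝ≥0} {U : Set E3} {η : E3 → E3}

protected lemma id (U : Set E3) : IsRegularEmbedding U id :=
  ⟨continuousOn_id, injOn_id U, fun _ _ => ⟨ContinuousLinearEquiv.refl ℝ E3, hasFDerivAtFilter_id _⟩⟩

lemma exists_injOn (h : IsRegularEmbedding U η) {x : E3} (hx : x ∈ closure U) :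
    ∃ W ∈ 𝓝 x, InjOn η (closure U ∩ W) := by
  obtain ⟨L, hL⟩ := h.exists_equiv x hx
  have hpos := nnnorm_symm_pos_of_equiv L
  obtain ⟨r, hr, -, happ⟩ := exists_approximatesLinearOn hL (c := ‖(L.symm : E3 →L[ℝ] E3)‖₊⁻¹ / 2)
    (half_pos (inv_pos.2 hpos)) univ_mem
  exact ⟨_, Metric.ball_mem_nhds x hr, happ.injOn (Or.inr (half_lt_self (inv_pos.2 hpos)))⟩

lemma map_nhds (hU : IsOpen U) (h : IsRegularEmbedding U η) {x : E3} (hx : x ∈ U) :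
    map η (𝓝 x) = 𝓝 (η x) := by
  obtain ⟨L, hL⟩ := h.exists_equiv x (subset_closure hx)
  exact (hasStrictFDerivAt_of_mem hU hx hL).map_nhds_eq_of_equiv

lemma isOpen_image (hU : IsOpen U) (h : IsRegularEmbedding U η) : IsOpen (η '' U) := by
  rw [isOpen_iff_mem_nhds]
  rintro _ ⟨x, hx, rfl⟩
  rw [← h.map_nhds hU hx]
  exact image_mem_map (hU.mem_nhds hx)

/-- An interior point shares its image with no other point of the closure. -/
lemma eq_of_mem (hU : IsOpen U) (h : IsRegularEmbedding U η) {x y : E3} (hx : x ∈ closure U)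
    (hy : y ∈ U) (hxy : η x = η y) : x = y := by
  by_contra hne
  obtain ⟨A, B, hA, hB, hxA, hyB, hAB⟩ := t2_separation hne
  have h1 : η '' (B ∩ U) ∈ 𝓝 (η x) := by
    rw [hxy, ← h.map_nhds hU hy]
    exact image_mem_map (inter_mem (hB.mem_nhds hyB) (hU.mem_nhds hy))
  have h2 : ∀ᶠ z in 𝓝[U] x, η z ∈ η '' (B ∩ U) :=
    ((h.continuousOn x hx).mono subset_closure) h1
  have : (𝓝[U] x).NeBot := mem_closure_iff_nhdsWithin_neBot.1 hx
  obtain ⟨z, ⟨⟨b, hb, hbz⟩, hzU⟩, hzA⟩ := ((h2.and self_mem_nhdsWithin).and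
    (mem_nhdsWithin_of_mem_nhds (hA.mem_nhds hxA))).exists
  have := h.injOn hb.2 hzU hbz
  exact disjoint_left.1 hAB hzA (this ▸ hb.1)

lemma mem_frontier_of_eq (hU : IsOpen U) (h : IsRegularEmbedding U η) {x y : E3}
    (hx : x ∈ frontier U) (hy : y ∈ closure U) (hxy : η x = η y) : y ∈ frontier U := by
  rw [hU.frontier_eq] at hx ⊢
  refine ⟨hy, fun hyU => hx.2 ?_⟩
  rwa [h.eq_of_mem hU hx.1 hyU hxy]

lemma exists_isInnerConormal (hU : IsC1HolderDomain α U) (h : IsRegularEmbedding U η) {x : E3}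
    (hx : x ∈ frontier U) : ∃ m, IsInnerConormal U η x m := by
  obtain ⟨φ, e, r, hg⟩ := hU.isC1Holder.exists_isLocalGraph hx
  obtain ⟨L, hL⟩ := h.exists_equiv x (frontier_subset_closure hx)
  set ℓ := fderiv ℝ φ x with hℓ
  have hle : ℓ e = 1 := hg.fderiv_apply_self x
  refine ⟨ℓ.comp (L.symm : E3 →L[ℝ] E3), fun v hv W hW => ?_, L e, by simp [hle], fun V hV ε hε => ?_⟩
  · obtain ⟨δ, t₀, r', hc⟩ := hg.exists_hasInwardCone (w := L.symm v) (by simpa using hv)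
    simpa using hc.exists_add_smul_mem_image hL hW
  · -- `Ψ` extends the restriction of `η` to the boundary, and has the same derivative at `x`
    have hφ0 : φ x = 0 := (hg.mem_frontier_iff hU.isOpen (Metric.mem_ball_self hg.r_pos)).1 hx
    have hs : HasStrictFDerivAt φ ℓ x := hg.contDiff.contDiffAt.hasStrictFDerivAt (by simp)
    set π : E3 → E3 := fun y => y - φ y • e with hπ
    have hπd : HasStrictFDerivAt π (ContinuousLinearMap.id ℝ E3 - ℓ.smulRight e) x :=
      (hasStrictFDerivAt_id x).sub (hs.smul_const e)
    have hπx : π x = x := by simp [hπ, hφ0]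
    have hπc : Tendsto π (𝓝 x) (𝓝 x) := by
      have := hπd.continuousAt.tendsto
      rwa [hπx] at this
    have hφπ : ∀ y, φ (π y) = 0 := fun y => by
      have := hg.shift y (-φ y)
      rw [neg_smul, ← sub_eq_add_neg] at this
      rw [hπ]; simp [this]
    have hπS : ∀ᶠ y in 𝓝 x, π y ∈ frontier U := by
      filter_upwards [hπc (Metric.ball_mem_nhds x hg.r_pos)] with y hy
      exact (hg.mem_frontier_iff hU.isOpen hy).2 (hφπ y)
    have hπD : Tendsto π (𝓝 x) (𝓝[closure U] x) := tendsto_nhdsWithin_iff.2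
      ⟨hπc, hπS.mono fun y hy => frontier_subset_closure hy⟩
    have h1 : HasStrictFDerivAt (η ∘ π) ((L : E3 →L[ℝ] E3) ∘L
        (ContinuousLinearMap.id ℝ E3 - ℓ.smulRight e)) x := by
      refine HasFDerivAtFilter.comp hL hπd ?_
      rw [nhds_prod_eq]
      exact hπD.prodMap hπD
    set Ψ : E3 → E3 := fun y => (η ∘ π) y + φ y • L e with hΨ
    have hΨd : HasStrictFDerivAt Ψ (L : E3 →L[ℝ] E3) x := by
      refine (h1.add (hs.smul_const (L e))).congr_fderiv ?_
      ext1 y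
      simp
    have hΨx : Ψ x = η x := by simp [hΨ, hπx, hφ0]
    rw [← hΨx, ← hΨd.map_nhds_eq_of_equiv]
    have hφc : Tendsto φ (𝓝 x) (𝓝 0) := by
      have := hg.contDiff.continuous.tendsto x
      rwa [hφ0] at this
    have hφε : ∀ᶠ y in 𝓝 x, |φ y| < ε := by
      have := hφc (Metric.ball_mem_nhds 0 hε)
      filter_upwards [this] with y hy
      simpa using hy
    change ∀ᶠ y in 𝓝 x, Ψ y ∈ _
    filter_upwards [hπS, hφε, hπc hV] with y hy1 hy2 hy3
    exact ⟨π y, ⟨hy1, hy3⟩, φ y, hy2, rfl⟩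

end IsRegularEmbedding

/-- Disjoint open half-spaces through the origin are opposite. -/
lemma exists_neg_smul_of_disjoint_halfspaces {E : Type*} [NormedAddCommGroup E] [NormedSpace ℝ E]
    {m₁ m₂ : E →L[ℝ] ℝ} (h₁ : ∃ v, 0 < m₁ v) (h₂ : ∃ v, 0 < m₂ v)
    (h : ∀ v, 0 < m₁ v → 0 < m₂ v → False) : ∃ c : ℝ, 0 < c ∧ m₂ = -(c • m₁) := by
  obtain ⟨v₁, hv₁⟩ := h₁
  obtain ⟨v₂, hv₂⟩ := h₂
  have hker : ∀ v, m₁ v = 0 → m₂ v = 0 := by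
    intro v hv
    by_contra hne
    refine h (v₁ + ((1 - m₂ v₁) / m₂ v) • v) ?_ ?_
    · simpa [hv] using hv₁
    · simp [hne]
  have hlin : ∀ v, m₂ v = m₂ v₁ / m₁ v₁ * m₁ v := by
    intro v
    have := hker (v - (m₁ v / m₁ v₁) • v₁) (by simp [hv₁.ne'])
    simp only [map_sub, map_smul, smul_eq_mul, sub_eq_zero] at this
    rw [this]; ring
  have hle : m₂ v₁ / m₁ v₁ < 0 := by
    rcases lt_trichotomy (m₂ v₁) 0 with h0 | h0 | h0
    · exact div_neg_of_neg_of_pos h0 hv₁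
    · rw [hlin v₂, h0] at hv₂; simp at hv₂
    · exact (h v₁ hv₁ h0).elim
  refine ⟨-(m₂ v₁ / m₁ v₁), neg_pos.2 hle, ?_⟩
  ext v
  simp [hlin v]

lemma IsInnerConormal.exists_pos {U : Set E3} {η : E3 → E3} {x : E3} {m : E3 →L[ℝ] ℝ}
    (h : IsInnerConormal U η x m) : ∃ v, 0 < m v := h.collar.imp fun _ hv => hv.1

namespace IsRegularEmbedding

variable {α : ℝ≥0} {U : Set E3} {η : E3 → E3}

lemma conormal_eq_neg_smul (h : IsRegularEmbedding U η) {x y : E3} (hx : x ∈ frontier U)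
    (hy : y ∈ frontier U) (hne : x ≠ y) (hxy : η x = η y) {m₁ m₂ : E3 →L[ℝ] ℝ}
    (h₁ : IsInnerConormal U η x m₁) (h₂ : IsInnerConormal U η y m₂) :
    ∃ c : ℝ, 0 < c ∧ m₂ = -(c • m₁) := by
  refine exists_neg_smul_of_disjoint_halfspaces h₁.exists_pos h₂.exists_pos fun v hv1 hv2 => ?_
  obtain ⟨A, B, hA, hB, hxA, hyB, hAB⟩ := t2_separation hne
  obtain ⟨V₁, hV₁, ε₁, hε₁, H₁⟩ := h₁.segment v hv1 A (hA.mem_nhds hxA)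
  obtain ⟨V₂, hV₂, ε₂, hε₂, H₂⟩ := h₂.segment v hv2 B (hB.mem_nhds hyB)
  have ht : 0 < min ε₁ ε₂ / 2 := half_pos (lt_min hε₁ hε₂)
  have ht2 : min ε₁ ε₂ / 2 < min ε₁ ε₂ := half_lt_self (lt_min hε₁ hε₂)
  obtain ⟨a, ha, hae⟩ := H₁ x ⟨frontier_subset_closure hx, mem_of_mem_nhds hV₁⟩ _
    ⟨ht, ht2.trans_le (min_le_left _ _)⟩
  obtain ⟨b, hb, hbe⟩ := H₂ y ⟨frontier_subset_closure hy, mem_of_mem_nhds hV₂⟩ _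
    ⟨ht, ht2.trans_le (min_le_right _ _)⟩
  have : a = b := h.injOn ha.1 hb.1 (by rw [hae, hbe, hxy])
  exact disjoint_left.1 hAB ha.2 (this ▸ hb.2)

/-- There are no three pairwise opposite half-spaces. -/
lemma eq_or_eq_or_eq_of_map_eq (hU : IsC1HolderDomain α U) (h : IsRegularEmbedding U η) {x y z : E3}
    (hx : x ∈ frontier U) (hy : y ∈ frontier U) (hz : z ∈ frontier U) (hxy : η x = η y)
    (hyz : η y = η z) : x = y ∨ x = z ∨ y = z := by
  by_contra! hne
  obtain ⟨m₁, h₁⟩ := h.exists_isInnerConormal hU hx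
  obtain ⟨m₂, h₂⟩ := h.exists_isInnerConormal hU hy
  obtain ⟨m₃, h₃⟩ := h.exists_isInnerConormal hU hz
  obtain ⟨a, ha, e1⟩ := h.conormal_eq_neg_smul hx hy hne.1 hxy h₁ h₂
  obtain ⟨b, hb, e2⟩ := h.conormal_eq_neg_smul hx hz hne.2.1 (hxy.trans hyz) h₁ h₃
  obtain ⟨c, hc, e3⟩ := h.conormal_eq_neg_smul hy hz hne.2.2 hyz h₂ h₃
  obtain ⟨v, hv⟩ := h₃.exists_pos
  have q1 : m₂ v = -(a * m₁ v) := by rw [e1]; simp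
  have q2 : m₃ v = -(b * m₁ v) := by rw [e2]; simp
  have q3 : m₃ v = -(c * m₂ v) := by rw [e3]; simp
  have h1 : m₁ v < 0 := by nlinarith
  have h2 : m₂ v < 0 := by nlinarith
  nlinarith

/-- By compactness of `closure U`, the fibres of `η` are upper semicontinuous. -/
lemma exists_nhds_preimage_subset (hb : Bornology.IsBounded U) (h : IsRegularEmbedding U η)
    {p : E3} {W : Set E3} (hW : IsOpen W) (hp : ∀ x ∈ closure U, η x = p → x ∈ W) :
    ∀ᶠ z in 𝓝 p, ∀ x ∈ closure U, η x = z → x ∈ W := by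
  have hcomp : IsCompact (η '' (closure U \ W)) :=
    (hb.isCompact_closure.diff hW).image_of_continuousOn (h.continuousOn.mono sdiff_subset)
  have hpn : p ∉ η '' (closure U \ W) := by
    rintro ⟨x, hx, hxp⟩
    exact hx.2 (hp x hx.1 hxp)
  filter_upwards [hcomp.isClosed.isOpen_compl.mem_nhds hpn] with z hz x hx hxz
  by_contra hxW
  exact hz ⟨x, ⟨hx, hxW⟩, hxz⟩

lemma eventually_injectiveAt (hb : Bornology.IsBounded U) (h : IsRegularEmbedding U η) {x : E3}
    (hx : x ∈ closure U) (hinj : InjectiveAt U η x) :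
    ∀ᶠ x' in 𝓝[closure U] x, InjectiveAt U η x' := by
  obtain ⟨W, hW, hWi⟩ := h.exists_injOn hx
  obtain ⟨W', hW'W, hW'o, hxW'⟩ := mem_nhds_iff.1 hW
  have h1 := h.exists_nhds_preimage_subset hb hW'o (p := η x) fun y hy hyx => by
    by_contra hyW
    exact hinj y ⟨hy, fun hyx' => hyW (hyx' ▸ hxW')⟩ hyx.symm
  filter_upwards [(h.continuousOn x hx) h1, self_mem_nhdsWithin,
    mem_nhdsWithin_of_mem_nhds (hW'o.mem_nhds hxW')] with x' hx'1 hx'2 hx'3 y hy hxy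
  refine hy.2 (hWi ⟨hy.1, hW'W (hx'1 y hy.1 hxy.symm)⟩ ⟨hx'2, hW'W hx'3⟩ hxy.symm)

lemma exists_mem_frontier_of_not_injectiveAt (hU : IsOpen U) (h : IsRegularEmbedding U η) {x : E3}
    (hx : x ∈ frontier U) (hinj : ¬ InjectiveAt U η x) : ∃ y ∈ frontier U, y ≠ x ∧ η x = η y := by
  simp only [InjectiveAt, not_forall, not_not] at hinj
  obtain ⟨y, hy, hxy⟩ := hinj
  exact ⟨y, h.mem_frontier_of_eq hU hx hy.1 hxy, hy.2, hxy⟩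

/-- If `η x` were interior, some `η x - t v` with `v` inward would be the image of a point `y` near `x`;
moving from `η y` back by `t v` would show that `η x` is the image of a point of `U`. -/
lemma notMem_interior_of_injectiveAt (hU : IsC1HolderDomain α U) (h : IsRegularEmbedding U η)
    {x : E3} (hx : x ∈ frontier U) (hinj : InjectiveAt U η x) :
    η x ∉ interior (η '' closure U) := by
  intro hint
  obtain ⟨m, hm⟩ := h.exists_isInnerConormal hU hx
  obtain ⟨v, hv⟩ := hm.exists_pos
  obtain ⟨V, hV, ε, hε, H⟩ := hm.segment v hv univ univ_mem
  have h1 := h.exists_nhds_preimage_subset hU.isBounded isOpen_interior (W := interior V) (p := η x)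
    fun y hy hyx => by
      by_contra hyW
      exact hinj y ⟨hy, fun hyx' => hyW (hyx' ▸ mem_interior_iff_mem_nhds.2 hV)⟩ hyx.symm
  have h2 := tendsto_sub_smul_nhdsGT (η x) v
  obtain ⟨t, ⟨ht1, ht2⟩, ht3⟩ := (((h2.eventually h1).and
    (h2.eventually (mem_interior_iff_mem_nhds.1 hint))).and (Ioo_mem_nhdsGT hε)).exists
  obtain ⟨y, hy, hye⟩ := ht2
  obtain ⟨a, ha, hae⟩ := H y ⟨hy, interior_subset (ht1 y hy hye)⟩ t ht3
  rw [hye, sub_add_cancel] at hae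
  have := h.eq_of_mem hU.isOpen (frontier_subset_closure hx) ha.1 hae.symm
  rw [hU.isOpen.frontier_eq] at hx
  exact hx.2 (this ▸ ha.1)

/-- If all boundary points near `x` are in self-contact, the image has both sides of the surface
`η '' frontier U` near `η x`: one from the neighbourhood of `x`, the other from that of the second
preimage of `η x`. -/
lemma mem_interior_of_eventually_not_injectiveAt (hU : IsC1HolderDomain α U)
    (h : IsRegularEmbedding U η) {x : E3} (hx : x ∈ frontier U)
    (hni : ∀ᶠ x' in 𝓝[frontier U] x, ¬ InjectiveAt U η x') :
    η x ∈ interior (η '' closure U) := by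
  obtain ⟨y, hy, hyx, hxy⟩ := h.exists_mem_frontier_of_not_injectiveAt hU.isOpen hx
    (hni.self_of_nhdsWithin hx)
  obtain ⟨m₁, h₁⟩ := h.exists_isInnerConormal hU hx
  obtain ⟨m₂, h₂⟩ := h.exists_isInnerConormal hU hy
  obtain ⟨c, hc, hm⟩ := h.conormal_eq_neg_smul hx hy hyx.symm hxy h₁ h₂
  obtain ⟨v, hv, hcollar⟩ := h₁.collar
  have hv2 : 0 < m₂ (-v) := by
    rw [hm]; simpa using mul_pos hc hv
  obtain ⟨V₁, hV₁, ε₁, hε₁, H₁⟩ := h₁.segment v hv univ univ_mem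
  obtain ⟨V₂, hV₂, ε₂, hε₂, H₂⟩ := h₂.segment (-v) hv2 univ univ_mem
  obtain ⟨W, hW, hWi⟩ := h.exists_injOn (frontier_subset_closure hx)
  -- the points near `η x` have their preimages near `x` or near `y`
  have hfib := h.exists_nhds_preimage_subset hU.isBounded (W := interior W ∪ interior V₂)
    (isOpen_interior.union isOpen_interior) (p := η x) fun z hz hzx => by
      have hzS := h.mem_frontier_of_eq hU.isOpen hx hz hzx.symm
      rcases h.eq_or_eq_or_eq_of_map_eq hU hx hy hzS hxy (hxy.symm.trans hzx.symm) with e | e | e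
      · exact absurd e.symm hyx
      · exact Or.inl (e ▸ mem_interior_iff_mem_nhds.2 hW)
      · exact Or.inr (e ▸ mem_interior_iff_mem_nhds.2 hV₂)
  have hfib' : ∀ᶠ x' in 𝓝[frontier U] x, ∀ z ∈ closure U, η z = η x' →
      z ∈ interior W ∪ interior V₂ :=
    ((h.continuousOn x (frontier_subset_closure hx)).mono frontier_subset_closure) hfib
  have hall := (hfib'.and hni)
  rw [eventually_nhdsWithin_iff] at hall
  rw [mem_interior_iff_mem_nhds]
  refine mem_of_superset (hcollar _ (inter_mem (inter_mem hV₁ hW) hall) (min ε₁ ε₂)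
    (lt_min hε₁ hε₂)) ?_
  rintro z ⟨x', ⟨hx'S, ⟨hx'1, hx'W⟩, hx'2⟩, t, ht, rfl⟩
  have hx'D := frontier_subset_closure hx'S
  -- for `t < 0` the point lies on the inner side of the surface at the partner `y'` of `x'`
  rcases lt_trichotomy t 0 with h0 | h0 | h0
  · obtain ⟨hx'3, hx'4⟩ := hx'2 hx'S
    obtain ⟨y', hy', hy'x, hxy'⟩ :=
      h.exists_mem_frontier_of_not_injectiveAt hU.isOpen hx'S hx'4
    have hy'D := frontier_subset_closure hy'
    have hy'V : y' ∈ V₂ := by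
      rcases hx'3 y' hy'D hxy'.symm with h5 | h5
      · exact absurd (hWi ⟨hy'D, interior_subset h5⟩ ⟨hx'D, hx'W⟩ hxy'.symm) hy'x
      · exact interior_subset h5
    have ht' : -t < ε₂ := by
      rw [abs_of_neg h0] at ht
      exact ht.trans_le (min_le_right _ _)
    obtain ⟨a, ha, hae⟩ := H₂ y' ⟨hy'D, hy'V⟩ (-t) ⟨neg_pos.2 h0, ht'⟩
    refine ⟨a, subset_closure ha.1, ?_⟩
    rw [hae, hxy', neg_smul_neg]
  · exact ⟨x', hx'D, by simp [h0]⟩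
  · have ht' : t < ε₁ := by
      rw [abs_of_pos h0] at ht
      exact ht.trans_le (min_le_left _ _)
    obtain ⟨a, ha, hae⟩ := H₁ x' ⟨hx'D, hx'1⟩ t ⟨h0, ht'⟩
    exact ⟨a, subset_closure ha.1, hae⟩

section Wall

variable {Ω : Set E3}

/-- The image touches the wall from inside, so their half-spaces at a contact point agree. -/
lemma conormal_wall_eq_smul (hΩ : IsOpen Ω)
    (hsub : η '' closure U ⊆ closure Ω) {x : E3} (hx : x ∈ frontier U) (hxΩ : η x ∈ frontier Ω)
    {m n : E3 →L[ℝ] ℝ} (hm : IsInnerConormal U η x m) (hn : IsInnerConormal Ω id (η x) n) :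
    ∃ c : ℝ, 0 < c ∧ n = c • m := by
  obtain ⟨v₀, hv₀⟩ := hn.exists_pos
  obtain ⟨c, hc, h⟩ := exists_neg_smul_of_disjoint_halfspaces (m₁ := m) (m₂ := -n) hm.exists_pos
    ⟨-v₀, by simpa using hv₀⟩ fun v hv1 hv2 => by
      obtain ⟨V₁, hV₁, ε₁, hε₁, H₁⟩ := hm.segment v hv1 univ univ_mem
      obtain ⟨V₂, hV₂, ε₂, hε₂, H₂⟩ := hn.segment (-v) (by simpa using hv2) univ univ_mem
      have h2 := tendsto_add_smul_nhdsGT (η x) v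
      obtain ⟨t, ⟨ht1, ht2⟩, ht3⟩ := (((h2.eventually hV₂).and (Ioo_mem_nhdsGT hε₁)).and
        (Ioo_mem_nhdsGT hε₂)).exists
      obtain ⟨a, ha, hae⟩ := H₁ x ⟨frontier_subset_closure hx, mem_of_mem_nhds hV₁⟩ t ht2
      obtain ⟨b, hb, hbe⟩ := H₂ (η x + t • v)
        ⟨hsub ⟨a, subset_closure ha.1, hae⟩, ht1⟩ t ht3
      simp only [id, smul_neg, add_neg_cancel_right] at hbe
      rw [hΩ.frontier_eq] at hxΩ
      exact hxΩ.2 (hbe ▸ hb.1)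
  exact ⟨c, hc, neg_injective h⟩

lemma injectiveAt_of_mem_frontier {β : ℝ≥0} (hΩ : IsC1HolderDomain β Ω) (hU : IsC1HolderDomain α U)
    (h : IsRegularEmbedding U η) (hsub : η '' closure U ⊆ closure Ω) {x : E3}
    (hx : x ∈ frontier U) (hxΩ : η x ∈ frontier Ω) : InjectiveAt U η x := by
  by_contra hinj
  obtain ⟨y, hy, hyx, hxy⟩ := h.exists_mem_frontier_of_not_injectiveAt hU.isOpen hx hinj
  obtain ⟨m₁, h₁⟩ := h.exists_isInnerConormal hU hx
  obtain ⟨m₂, h₂⟩ := h.exists_isInnerConormal hU hy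
  obtain ⟨n, hn⟩ := (IsRegularEmbedding.id Ω).exists_isInnerConormal hΩ hxΩ
  obtain ⟨a, ha, e1⟩ := conormal_wall_eq_smul hΩ.isOpen hsub hx hxΩ h₁ hn
  obtain ⟨b, hb, e2⟩ := conormal_wall_eq_smul hΩ.isOpen hsub hy (hxy ▸ hxΩ) h₂ (hxy ▸ hn)
  obtain ⟨c, hc, e3⟩ := h.conormal_eq_neg_smul hx hy hyx.symm hxy h₁ h₂
  obtain ⟨v, hv⟩ := hn.exists_pos
  have q1 : n v = a * m₁ v := by rw [e1]; simp
  have q2 : n v = b * m₂ v := by rw [e2]; simp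
  have q3 : m₂ v = -(c * m₁ v) := by rw [e3]; simp
  have p1 : 0 < m₁ v := by
    rw [q1] at hv; exact (mul_pos_iff_of_pos_left ha).1 hv
  have p2 : 0 < m₂ v := by
    rw [q2] at hv; exact (mul_pos_iff_of_pos_left hb).1 hv
  nlinarith

/-- If a whole neighbourhood of `x` in the boundary is in contact with the wall, the image fills the
part of `Ω` near `η x`. -/
lemma image_mem_nhdsWithin_of_wall {β : ℝ≥0} (hΩ : IsC1HolderDomain β Ω)
    (hU : IsC1HolderDomain α U)
    (h : IsRegularEmbedding U η) (hsub : η '' closure U ⊆ closure Ω) {x : E3}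
    (hx : x ∈ frontier U) (hwall : ∀ᶠ x' in 𝓝[frontier U] x, η x' ∈ frontier Ω) :
    η '' closure U ∈ 𝓝[Ω] (η x) := by
  have hxΩ : η x ∈ frontier Ω := hwall.self_of_nhdsWithin hx
  obtain ⟨m, hm⟩ := h.exists_isInnerConormal hU hx
  obtain ⟨n, hn⟩ := (IsRegularEmbedding.id Ω).exists_isInnerConormal hΩ hxΩ
  obtain ⟨c, hc, e⟩ := conormal_wall_eq_smul hΩ.isOpen hsub hx hxΩ hm hn
  obtain ⟨v, hv, hcollar⟩ := hm.collar
  obtain ⟨V₁, hV₁, ε₁, hε₁, H₁⟩ := hm.segment v hv univ univ_mem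
  obtain ⟨V₂, hV₂, ε₂, hε₂, H₂⟩ := hn.segment v (by rw [e]; simpa using mul_pos hc hv)
    univ univ_mem
  rw [eventually_nhdsWithin_iff] at hwall
  have hall := inter_mem (hcollar _ (inter_mem hV₁ hwall) (min ε₁ ε₂) (lt_min hε₁ hε₂)) hV₂
  filter_upwards [mem_nhdsWithin_of_mem_nhds hall, self_mem_nhdsWithin] with z hz hzΩ
  obtain ⟨⟨x', ⟨hx'S, hx'1, hx'2⟩, t, ht, rfl⟩, hzV⟩ := hz
  have hx'D := frontier_subset_closure hx'S
  -- for `t < 0` the point is outside `Ω`: otherwise the wall point `η x'` would be inside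
  rcases lt_trichotomy t 0 with h0 | h0 | h0
  · have ht' : -t < ε₂ := by
      rw [abs_of_neg h0] at ht
      exact ht.trans_le (min_le_right _ _)
    obtain ⟨b, hb, hbe⟩ := H₂ _ ⟨subset_closure hzΩ, hzV⟩ (-t) ⟨neg_pos.2 h0, ht'⟩
    simp only [id, neg_smul, add_neg_cancel_right] at hbe
    have := hx'2 hx'S
    rw [hΩ.isOpen.frontier_eq] at this
    exact absurd (hbe ▸ hb.1) this.2
  · exact ⟨x', hx'D, by simp [h0]⟩
  · have ht' : t < ε₁ := by
      rw [abs_of_pos h0] at ht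
      exact ht.trans_le (min_le_left _ _)
    obtain ⟨a, ha, hae⟩ := H₁ x' ⟨hx'D, hx'1⟩ t ⟨h0, ht'⟩
    exact ⟨a, subset_closure ha.1, hae⟩

end Wall

end IsRegularEmbedding

/-! ### Boundaries of the solid and the fluid domain -/

lemma mem_relInterior_iff {S A : Set E3} {x : E3} :
    x ∈ relInterior S A ↔ x ∈ S ∧ ∀ᶠ y in 𝓝[S] x, y ∈ A := by
  simp only [relInterior, mem_image, Subtype.exists, exists_and_right, exists_eq_right]
  refine ⟨fun ⟨hx, h⟩ => ⟨hx, ?_⟩, fun ⟨hx, h⟩ => ⟨hx, ?_⟩⟩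
  · rwa [mem_interior_iff_mem_nhds, preimage_coe_mem_nhds_subtype] at h
  · rwa [mem_interior_iff_mem_nhds, preimage_coe_mem_nhds_subtype]

lemma mem_relFrontier_iff {S A : Set E3} {x : E3} :
    x ∈ relFrontier S A ↔ x ∈ S ∧ (∃ᶠ y in 𝓝[S] x, y ∈ A) ∧ ∃ᶠ y in 𝓝[S] x, y ∉ A := by
  have key : ∀ (B : Set E3) (hx : x ∈ S), (⟨x, hx⟩ : S) ∈ closure (((↑) : S → E3) ⁻¹' B) ↔
      ∃ᶠ y in 𝓝[S] x, y ∈ B := fun B hx => by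
    rw [mem_closure_iff_frequently, ← map_nhds_subtype_val (⟨x, hx⟩ : S), frequently_map]
    rfl
  simp only [relFrontier, mem_image, Subtype.exists, exists_and_right, exists_eq_right,
    frontier_eq_closure_inter_closure, mem_inter_iff, ← preimage_compl, key, mem_compl_iff]
  tauto

/-- Fatou's lemma for sets; continuity of a measure along increasing unions needs no measurability. -/
lemma measure_le_liminf_of_eventually_mem {X : Type*} [MeasurableSpace X] (μ : Measure X)
    {A : Set X} {B : ℕ → Set X} (h : ∀ x ∈ A, ∀ᶠ n in atTop, x ∈ B n) :
    μ A ≤ liminf (fun n => μ (B n)) atTop := by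
  set T : ℕ → Set X := fun n => {x | ∀ k, n ≤ k → x ∈ B k} with hT
  have hmono : Monotone T := fun a b hab x hx k hk => hx k (hab.trans hk)
  have hA : A ⊆ ⋃ n, T n := fun x hx => by
    obtain ⟨n, hn⟩ := eventually_atTop.1 (h x hx)
    exact mem_iUnion.2 ⟨n, hn⟩
  rw [liminf_eq_iSup_iInf_of_nat]
  refine (measure_mono hA).trans (hmono.measure_iUnion.trans_le (iSup_mono fun n => ?_))
  exact le_iInf₂ fun k hk => measure_mono fun x hx => hx k hk

lemma isOpen_solidDomain {U : Set E3} {η : E3 → E3} : IsOpen (solidDomain U η) := isOpen_interior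

namespace IsRegularEmbedding

variable {α β : ℝ≥0} {Ω U : Set E3} {η : E3 → E3}

lemma isClosed_image (hb : Bornology.IsBounded U) (h : IsRegularEmbedding U η) :
    IsClosed (η '' closure U) :=
  (hb.isCompact_closure.image_of_continuousOn h.continuousOn).isClosed

lemma image_subset_solidDomain (hU : IsOpen U) (h : IsRegularEmbedding U η) :
    η '' U ⊆ solidDomain U η :=
  interior_maximal (image_mono subset_closure) (h.isOpen_image hU)

lemma closure_solidDomain (hU : IsC1HolderDomain α U) (h : IsRegularEmbedding U η) :
    closure (solidDomain U η) = η '' closure U :=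
  Subset.antisymm (closure_minimal interior_subset (h.isClosed_image hU.isBounded))
    (h.continuousOn.image_closure.trans (closure_mono (h.image_subset_solidDomain hU.isOpen)))

lemma frontier_solidDomain (hU : IsC1HolderDomain α U) (h : IsRegularEmbedding U η) :
    frontier (solidDomain U η) = η '' closure U \ solidDomain U η := by
  rw [isOpen_solidDomain.frontier_eq, h.closure_solidDomain hU]

lemma mem_solidDomain_iff (hU : IsC1HolderDomain α U) (h : IsRegularEmbedding U η) {x : E3}
    (hx : x ∈ frontier U) :
    η x ∈ solidDomain U η ↔ ∀ᶠ x' in 𝓝[frontier U] x, ¬ InjectiveAt U η x' := by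
  refine ⟨fun hO => ?_, h.mem_interior_of_eventually_not_injectiveAt hU hx⟩
  have hc : ContinuousWithinAt η (frontier U) x :=
    (h.continuousOn x (frontier_subset_closure hx)).mono frontier_subset_closure
  filter_upwards [hc (isOpen_interior.mem_nhds hO), self_mem_nhdsWithin] with x' h1 h2 hinj
  exact h.notMem_interior_of_injectiveAt hU h2 hinj h1

lemma exists_of_mem_frontier_solidDomain (hU : IsC1HolderDomain α U) (h : IsRegularEmbedding U η)
    {p : E3} (hp : p ∈ frontier (solidDomain U η)) : ∃ x ∈ frontier U, η x = p := by
  rw [h.frontier_solidDomain hU] at hp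
  obtain ⟨⟨x, hx, rfl⟩, hpO⟩ := hp
  refine ⟨x, ?_, rfl⟩
  rw [hU.isOpen.frontier_eq]
  exact ⟨hx, fun hxU => hpO (h.image_subset_solidDomain hU.isOpen ⟨x, hxU, rfl⟩)⟩

lemma mem_frontier_solidDomain_iff (hU : IsC1HolderDomain α U) (h : IsRegularEmbedding U η)
    {x : E3} (hx : x ∈ frontier U) :
    η x ∈ frontier (solidDomain U η) ↔ ∃ᶠ x' in 𝓝[frontier U] x, InjectiveAt U η x' := by
  rw [h.frontier_solidDomain hU, Set.mem_sdiff, h.mem_solidDomain_iff hU hx, not_eventually]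
  simp only [not_not, and_iff_right_iff_imp]
  exact fun _ => ⟨x, frontier_subset_closure hx, rfl⟩

theorem frontier_solidDomain_eq (hΩ : IsC1HolderDomain β Ω) (hU : IsC1HolderDomain α U)
    (h : IsRegularEmbedding U η) (hsub : η '' closure U ⊆ closure Ω) :
    frontier (solidDomain U η) = η '' noContact Ω U η ∪ η '' wallContact Ω U η ∪
      η '' relFrontier (frontier U) (selfContact Ω U η) := by
  have hinjC : ∀ x ∈ wallContact Ω U η, InjectiveAt U η x := fun x hx =>
    h.injectiveAt_of_mem_frontier hΩ hU hsub hx.1 hx.2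
  have hfreq : ∀ x ∈ frontier U, InjectiveAt U η x → η x ∈ frontier (solidDomain U η) := by
    intro x hx hinj
    rw [h.mem_frontier_solidDomain_iff hU hx]
    intro hev
    exact hev.self_of_nhdsWithin hx hinj
  refine Subset.antisymm (fun p hp => ?_) ?_
  · obtain ⟨x, hx, rfl⟩ := h.exists_of_mem_frontier_solidDomain hU hp
    by_cases hC : x ∈ wallContact Ω U η
    · exact Or.inl (Or.inr ⟨x, hC, rfl⟩)
    by_cases hinj : InjectiveAt U η x
    · exact Or.inl (Or.inl ⟨x, ⟨⟨hx, hC⟩, hinj⟩, rfl⟩)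
    refine Or.inr ⟨x, mem_relFrontier_iff.2 ⟨hx, ?_, ?_⟩, rfl⟩
    · intro hev
      exact hev.self_of_nhdsWithin hx ⟨⟨hx, hC⟩, hinj⟩
    · rw [h.mem_frontier_solidDomain_iff hU hx] at hp
      exact hp.mono fun y hy hyN => hyN.2 hy
  · rintro _ ((⟨x, hx, rfl⟩ | ⟨x, hx, rfl⟩) | ⟨x, hx, rfl⟩)
    · exact hfreq x hx.1.1 hx.2
    · exact hfreq x hx.1 (hinjC x hx)
    · obtain ⟨hxS, -, hx2⟩ := mem_relFrontier_iff.1 hx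
      rw [h.mem_frontier_solidDomain_iff hU hxS]
      refine (hx2.and_eventually self_mem_nhdsWithin).mono fun y hy => ?_
      by_contra hyi
      exact hy.1 ⟨⟨hy.2, fun hyC => hyi (hinjC y hyC)⟩, hyi⟩

lemma fluidDomain_eq (hΩ : IsOpen Ω) (hU : IsC1HolderDomain α U)
    (h : IsRegularEmbedding U η) : fluidDomain Ω U η = Ω \ η '' closure U := by
  rw [fluidDomain, sdiff_eq, interior_inter, hΩ.interior_eq, interior_compl,
    h.closure_solidDomain hU, sdiff_eq]

lemma mem_of_notMem_wallContact (hΩ : IsOpen Ω) (hsub : η '' closure U ⊆ closure Ω) {x : E3}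
    (hx : x ∈ frontier U) (hxC : x ∉ wallContact Ω U η) : η x ∈ Ω := by
  by_contra hn
  refine hxC ⟨hx, ?_⟩
  rw [hΩ.frontier_eq]
  exact ⟨hsub ⟨x, frontier_subset_closure hx, rfl⟩, hn⟩

lemma closure_noContact_subset : closure (noContact Ω U η) ⊆ frontier U :=
  closure_minimal (fun _ hx => hx.1.1) isClosed_frontier

lemma mem_closure_noContact_of_frequently {x : E3}
    (h1 : ∃ᶠ y in 𝓝[frontier U] x, InjectiveAt U η y)
    (h2 : ∀ᶠ y in 𝓝[frontier U] x, InjectiveAt U η y → y ∉ wallContact Ω U η) :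
    x ∈ closure (noContact Ω U η) := by
  rw [mem_closure_iff_frequently]
  have := (h1.and_eventually (h2.and self_mem_nhdsWithin)).mono
    fun y hy => (⟨⟨hy.2.2, hy.2.1 hy.1⟩, hy.1⟩ : y ∈ noContact Ω U η)
  exact this.filter_mono nhdsWithin_le_nhds

theorem frontier_fluidDomain_eq (hΩ : IsC1HolderDomain β Ω) (hU : IsC1HolderDomain α U)
    (h : IsRegularEmbedding U η) (hsub : η '' closure U ⊆ closure Ω) :
    frontier (fluidDomain Ω U η) = η '' closure (noContact Ω U η) ∪
      (frontier Ω \ η '' relInterior (frontier U) (wallContact Ω U η)) := by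
  have hinjC : ∀ x ∈ wallContact Ω U η, InjectiveAt U η x := fun x hx =>
    h.injectiveAt_of_mem_frontier hΩ hU hsub hx.1 hx.2
  have hOΩ : solidDomain U η ⊆ Ω := by
    rw [← hΩ.interior_closure]; exact interior_mono hsub
  have hcont : ∀ x ∈ frontier U, Tendsto η (𝓝[frontier U] x) (𝓝 (η x)) := fun x hx =>
    (h.continuousOn x (frontier_subset_closure hx)).mono frontier_subset_closure
  have hFo : IsOpen (Ω \ η '' closure U) := hΩ.isOpen.sdiff (h.isClosed_image hU.isBounded)
  rw [h.fluidDomain_eq hΩ.isOpen hU]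
  refine Subset.antisymm (fun p hp => ?_) (union_subset ?_ fun p hp => ?_)
  · rw [hFo.frontier_eq] at hp
    have hfr := mem_closure_iff_frequently.1 hp.1
    by_cases hpΩ : p ∈ Ω
    · left
      obtain ⟨x, hx, rfl⟩ : p ∈ η '' closure U := by
        by_contra hn; exact hp.2 ⟨hpΩ, hn⟩
      have hpO : η x ∉ solidDomain U η := fun hO => by
        have hev : ∀ᶠ z in 𝓝 (η x), z ∈ solidDomain U η := isOpen_solidDomain.mem_nhds hO
        exact hfr (hev.mono fun z hz hzF => hzF.2 (interior_subset hz))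
      have hpS : η x ∈ frontier (solidDomain U η) := by
        rw [h.frontier_solidDomain hU]; exact ⟨⟨x, hx, rfl⟩, hpO⟩
      have hxS : x ∈ frontier U := by
        rw [hU.isOpen.frontier_eq]
        exact ⟨hx, fun hxU => hpO (h.image_subset_solidDomain hU.isOpen ⟨x, hxU, rfl⟩)⟩
      refine ⟨x, mem_closure_noContact_of_frequently
        ((h.mem_frontier_solidDomain_iff hU hxS).1 hpS) ?_, rfl⟩
      filter_upwards [hcont x hxS (hΩ.isOpen.mem_nhds hpΩ)] with y hy _ hyC
      have := hyC.2
      rw [hΩ.isOpen.frontier_eq] at this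
      exact this.2 hy
    · right
      refine ⟨by rw [hΩ.isOpen.frontier_eq]; exact ⟨closure_mono sdiff_subset hp.1, hpΩ⟩, ?_⟩
      rintro ⟨x, hx, rfl⟩
      obtain ⟨hxS, hev⟩ := mem_relInterior_iff.1 hx
      have := h.image_mem_nhdsWithin_of_wall hΩ hU hsub hxS (hev.mono fun y hy => hy.2)
      rw [mem_nhdsWithin_iff_eventually] at this
      exact hfr (this.mono fun z hz hzF => hzF.2 (hz hzF.1))
  · refine ((h.continuousOn.mono (closure_noContact_subset.trans
      frontier_subset_closure)).image_closure).trans (closure_minimal ?_ isClosed_frontier)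
    rintro _ ⟨x, hx, rfl⟩
    have hxΩ := mem_of_notMem_wallContact hΩ.isOpen hsub hx.1.1 hx.1.2
    rw [hFo.frontier_eq]
    refine ⟨mem_closure_iff_frequently.2 fun hev => ?_,
      fun hF => hF.2 ⟨x, frontier_subset_closure hx.1.1, rfl⟩⟩
    refine h.notMem_interior_of_injectiveAt hU hx.1.1 hx.2 (mem_interior_iff_mem_nhds.2 ?_)
    filter_upwards [hev, hΩ.isOpen.mem_nhds hxΩ] with z hz hzΩ
    by_contra hn
    exact hz ⟨hzΩ, hn⟩
  · have hpF := hp.1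
    rw [hΩ.isOpen.frontier_eq] at hpF
    rw [hFo.frontier_eq]
    refine ⟨mem_closure_iff_frequently.2 fun hev => hp.2 ?_, fun hF => hpF.2 hF.1⟩
    have hev' : ∀ᶠ z in 𝓝 p, z ∈ Ω → z ∈ η '' closure U := hev.mono fun z hz hzΩ => by
      by_contra hn; exact hz ⟨hzΩ, hn⟩
    have hpK : p ∈ η '' closure U := by
      rw [← (h.isClosed_image hU.isBounded).closure_eq]
      exact mem_closure_iff_frequently.2
        (((mem_closure_iff_frequently.1 hpF.1).and_eventually hev').mono fun z hz => hz.2 hz.1)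
    obtain ⟨x, hx, rfl⟩ := hpK
    have hxS : x ∈ frontier U := by
      rw [hU.isOpen.frontier_eq]
      exact ⟨hx, fun hxU => hpF.2 (hOΩ (h.image_subset_solidDomain hU.isOpen ⟨x, hxU, rfl⟩))⟩
    refine ⟨x, mem_relInterior_iff.2 ⟨hxS, ?_⟩, rfl⟩
    have hinj := (h.eventually_injectiveAt hU.isBounded hx (hinjC x ⟨hxS, hp.1⟩)).filter_mono
      (nhdsWithin_mono x frontier_subset_closure)
    filter_upwards [hinj, self_mem_nhdsWithin,
      hcont x hxS (eventually_eventually_nhds.2 hev')] with y hy1 hy2 hy3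
    by_contra hyC
    have hyΩ := mem_of_notMem_wallContact hΩ.isOpen hsub hy2 hyC
    refine h.notMem_interior_of_injectiveAt hU hy2 hy1 (mem_interior_iff_mem_nhds.2 ?_)
    have hy3' : ∀ᶠ z in 𝓝 (η y), z ∈ Ω → z ∈ η '' closure U := hy3
    filter_upwards [hy3', hΩ.isOpen.mem_nhds hyΩ] with z hz1 hz2 using hz1 hz2

theorem frontier_inter_frontier_eq (hΩ : IsC1HolderDomain β Ω) (hU : IsC1HolderDomain α U)
    (h : IsRegularEmbedding U η) (hsub : η '' closure U ⊆ closure Ω) :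
    frontier (solidDomain U η) ∩ frontier (fluidDomain Ω U η) =
      η '' closure (noContact Ω U η) := by
  refine Subset.antisymm ?_ (subset_inter ?_ ?_)
  · rintro p ⟨hp1, hp2⟩
    rw [h.frontier_fluidDomain_eq hΩ hU hsub] at hp2
    rcases hp2 with hp2 | hp2
    · exact hp2
    obtain ⟨x, hxS, rfl⟩ := h.exists_of_mem_frontier_solidDomain hU hp1
    have hinj := (h.eventually_injectiveAt hU.isBounded (frontier_subset_closure hxS)
      (h.injectiveAt_of_mem_frontier hΩ hU hsub hxS hp2.1)).filter_mono
      (nhdsWithin_mono x frontier_subset_closure)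
    have hfr : ∃ᶠ y in 𝓝[frontier U] x, y ∉ wallContact Ω U η := fun hev =>
      hp2.2 ⟨x, mem_relInterior_iff.2 ⟨hxS, hev.mono fun y hy => not_not.1 hy⟩, rfl⟩
    refine ⟨x, mem_closure_iff_frequently.2 ?_, rfl⟩
    have := (hfr.and_eventually (hinj.and self_mem_nhdsWithin)).mono
      fun y hy => (⟨⟨hy.2.2, hy.1⟩, hy.2.1⟩ : y ∈ noContact Ω U η)
    exact this.filter_mono nhdsWithin_le_nhds
  · refine ((h.continuousOn.mono (closure_noContact_subset.trans
      frontier_subset_closure)).image_closure).trans (closure_minimal ?_ isClosed_frontier)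
    rw [h.frontier_solidDomain_eq hΩ hU hsub]
    exact subset_union_left.trans subset_union_left
  · rw [h.frontier_fluidDomain_eq hΩ hU hsub]
    exact subset_union_left

end IsRegularEmbedding

/-! ### Stability of the contact-free set -/

/-- Absence of contact persists under convergence: near `x` the maps `ηs n` are injective because their
Lipschitz distance to `η` tends to `0`, and away from `x` their values stay away from `η x`. -/
lemma eventually_mem_noContact {α β : ℝ≥0} {q : ℝ} (hq : 3 < q) {Ω U : Set E3}
    (hΩ : IsC1HolderDomain β Ω) (hU : IsC1HolderDomain α U) {η : E3 → E3}
    (hη : IsDeformation q Ω U η) (hsub : η '' closure U ⊆ closure Ω) {ηs : ℕ → E3 → E3}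
    (hηs : ∀ n, IsDeformation q Ω U (ηs n)) (hlim : TendstoDeformation q U ηs η) {x : E3}
    (hx : x ∈ noContact Ω U η) : ∀ᶠ n in atTop, x ∈ noContact Ω U (ηs n) := by
  have h := hη.isRegularEmbedding hq hU
  have hUo := hU.isOpen
  have hUfin : volume U ≠ ⊤ := hU.isBounded.measure_lt_top.ne
  set f : ℕ → E3 → E3 := fun n x => ηs n x - η x with hf
  have hfW : ∀ n, MemW2 q U (f n) := fun n => (hηs n).memW2.sub hq hUo hUfin hη.memW2
  have hfc : ∀ n, ContinuousOn (f n) (closure U) := fun n =>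
    (hηs n).continuousOn.sub hη.continuousOn
  have hN : Tendsto (fun n => (normW2 q U (f n)).toReal) atTop (𝓝 0) :=
    (ENNReal.tendsto_toReal ENNReal.zero_ne_top).comp hlim
  have hxD : x ∈ closure U := frontier_subset_closure hx.1.1
  have hest : ∀ y ∈ closure U, ∃ r > 0, ∃ N : ℕ → ℝ, Tendsto N atTop (𝓝 0) ∧ ∀ n,
      ∀ a ∈ closure U ∩ Metric.ball y r, ‖f n a‖ ≤ N n ∧
        ∀ b ∈ closure U ∩ Metric.ball y r, ‖f n a - f n b‖ ≤ N n * ‖a - b‖ := by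
    intro y hy
    obtain ⟨e, δ, t₀, r, hc⟩ := hU.exists_hasInwardCone hy
    obtain ⟨r', hr', C, hC, H⟩ := hc.exists_norm_sub_le (F := E3) hq hUo hUfin
    refine ⟨r', hr', fun n => C * (normW2 q U (f n)).toReal, ?_, fun n => H _ (hfW n) (hfc n)⟩
    simpa using hN.const_mul C
  have hpt : Tendsto (fun n => f n x) atTop (𝓝 0) := by
    obtain ⟨r, hr, N, hN0, H⟩ := hest x hxD
    exact squeeze_zero_norm (fun n => (H n x ⟨hxD, Metric.mem_ball_self hr⟩).1) hN0
  have hwall : ∀ᶠ n in atTop, x ∉ wallContact Ω U (ηs n) := by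
    have h1 : Tendsto (fun n => ηs n x) atTop (𝓝 (η x)) := by
      simpa [hf] using hpt.add_const (η x)
    have h2 := IsRegularEmbedding.mem_of_notMem_wallContact hΩ.isOpen hsub hx.1.1 hx.1.2
    filter_upwards [h1 (hΩ.isOpen.mem_nhds h2)] with n hn hC
    have := hC.2
    rw [hΩ.isOpen.frontier_eq] at this
    exact this.2 hn
  have hinj : ∀ᶠ n in atTop, ∀ y ∈ closure U, y ≠ x → ηs n x ≠ ηs n y := by
    refine hU.isBounded.isCompact_closure.induction_on
      (p := fun s => ∀ᶠ n in atTop, ∀ y ∈ s, y ≠ x → ηs n x ≠ ηs n y)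
      (by simp) (fun s t hst ht => ht.mono fun n hn y hy => hn y (hst hy))
      (fun s t hs ht => (hs.and ht).mono fun n hn y hy => hy.elim (hn.1 y) (hn.2 y)) fun y hy => ?_
    obtain ⟨r, hr, N, hN0, H⟩ := hest y hy
    have hball : Metric.ball y r ∈ 𝓝 y := Metric.ball_mem_nhds y hr
    rcases eq_or_ne y x with rfl | hyx
    · obtain ⟨L, hL⟩ := h.exists_equiv y hy
      have hpos := nnnorm_symm_pos_of_equiv L
      set c := ‖(L.symm : E3 →L[ℝ] E3)‖₊⁻¹ / 3 with hc
      have hc0 : 0 < c := div_pos (inv_pos.2 hpos) (by norm_num)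
      obtain ⟨s, hs, hsr, happ⟩ := exists_approximatesLinearOn hL hc0 hball
      refine ⟨_, inter_mem self_mem_nhdsWithin
        (mem_nhdsWithin_of_mem_nhds (Metric.ball_mem_nhds y hs)), ?_⟩
      filter_upwards [hN0.eventually_le_const (NNReal.coe_pos.2 hc0)] with n hn
      have happ' : ApproximatesLinearOn (ηs n) (L : E3 →L[ℝ] E3) (closure U ∩ Metric.ball y s)
          (c + c) := by
        intro a ha b hb
        have h1 := happ a ha b hb
        have h2 := (H n a ⟨ha.1, hsr ha.2⟩).2 b ⟨hb.1, hsr hb.2⟩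
        have h3 : ηs n a - ηs n b - (L : E3 →L[ℝ] E3) (a - b) =
            (η a - η b - (L : E3 →L[ℝ] E3) (a - b)) + (f n a - f n b) := by
          simp only [hf]; abel
        rw [h3, NNReal.coe_add, add_mul]
        refine (norm_add_le _ _).trans (add_le_add h1 (h2.trans ?_))
        gcongr
      have hlt : c + c < ‖(L.symm : E3 →L[ℝ] E3)‖₊⁻¹ := by
        have h4 : 0 < ‖(L.symm : E3 →L[ℝ] E3)‖₊⁻¹ := inv_pos.2 hpos
        rw [← NNReal.coe_lt_coe, NNReal.coe_add, hc, NNReal.coe_div]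
        have h5 := NNReal.coe_pos.2 h4
        push_cast at h5 ⊢
        linarith
      intro y' hy' hne heq
      exact hne (happ'.injOn (Or.inr hlt) hy' ⟨hy, Metric.mem_ball_self hs⟩ heq.symm)
    · have hd : 0 < ‖η x - η y‖ := norm_pos_iff.2 (sub_ne_zero.2 (hx.2 y ⟨hy, hyx⟩))
      have hd4 : 0 < ‖η x - η y‖ / 4 := by positivity
      refine ⟨_, inter_mem (inter_mem self_mem_nhdsWithin (mem_nhdsWithin_of_mem_nhds hball))
        (hη.continuousOn y hy (Metric.ball_mem_nhds (η y) hd4)), ?_⟩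
      filter_upwards [hN0.eventually_lt_const hd4, hpt (Metric.ball_mem_nhds 0 hd4)] with n hn1 hn2
      intro y' hy' _ heq
      have h1 := (H n y' hy'.1).1
      have h2 : ‖η y' - η y‖ < ‖η x - η y‖ / 4 := mem_ball_iff_norm.1 hy'.2
      have h3 : ‖f n x‖ < ‖η x - η y‖ / 4 := by simpa using hn2
      have h4 : η x - η y = (η y' - η y) + (f n y' - f n x) := by
        simp only [hf]
        rw [heq]
        abel
      have h5 : ‖η x - η y‖ ≤ ‖η y' - η y‖ + (‖f n y'‖ + ‖f n x‖) := by
        conv_lhs => rw [h4]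
        exact (norm_add_le _ _).trans (add_le_add le_rfl (norm_sub_le _ _))
      linarith
  filter_upwards [hwall, hinj] with n hn1 hn2
  exact ⟨⟨hx.1.1, hn1⟩, fun y hy => hn2 y hy.1 hy.2⟩

end FSI

open FSI in
theorem lemma3p1 (α : ℝ≥0) (hα : 0 < α) (hα1 : α ≤ 1) (q : ℝ) (hq : 3 < q)
    (Ω ΩS : Set E3) (hΩ : IsC1HolderDomain α Ω) (hΩS : IsC1HolderDomain α ΩS)
    (η : E3 → E3) (hη : IsDeformation q Ω ΩS η) :
    (∀ x ∈ wallContact Ω ΩS η, ∀ y ∈ wallContact Ω ΩS η, η x = η y → x = y) ∧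
    (∀ x ∈ selfContact Ω ΩS η, ∀ y ∈ selfContact Ω ΩS η, ∀ z ∈ selfContact Ω ΩS η,
      η x = η y → η y = η z → x = y ∨ x = z ∨ y = z) ∧
    (frontier (solidDomain ΩS η) =
      η '' noContact Ω ΩS η ∪ η '' wallContact Ω ΩS η ∪
        η '' relFrontier (frontier ΩS) (selfContact Ω ΩS η)) ∧
    (frontier (fluidDomain Ω ΩS η) =
      η '' closure (noContact Ω ΩS η) ∪
        (frontier Ω \ η '' relInterior (frontier ΩS) (wallContact Ω ΩS η))) ∧
    (frontier (solidDomain ΩS η) ∩ frontier (fluidDomain Ω ΩS η) =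
      η '' closure (noContact Ω ΩS η)) ∧
    (∀ ηs : ℕ → E3 → E3, (∀ n, IsDeformation q Ω ΩS (ηs n)) →
      TendstoDeformation q ΩS ηs η →
      μHE[2] (noContact Ω ΩS η) ≤ liminf (fun n => μHE[2] (noContact Ω ΩS (ηs n))) atTop) := by
  have h := hη.isRegularEmbedding hq hΩS
  have hsub : η '' closure ΩS ⊆ closure Ω := by
    rw [← h.closure_solidDomain hΩS]
    exact hη.closure_subset
  refine ⟨fun x hx y hy hxy => ?_, fun x hx y hy z hz hxy hyz =>
    h.eq_or_eq_or_eq_of_map_eq hΩS hx.1.1 hy.1.1 hz.1.1 hxy hyz, h.frontier_solidDomain_eq hΩ hΩS hsub,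
    h.frontier_fluidDomain_eq hΩ hΩS hsub, h.frontier_inter_frontier_eq hΩ hΩS hsub,
    fun ηs hηs hlim => measure_le_liminf_of_eventually_mem _ fun x hx =>
      eventually_mem_noContact hq hΩ hΩS hη hsub hηs hlim hx⟩
  by_contra hne
  exact h.injectiveAt_of_mem_frontier hΩ hΩS hsub hx.1 hx.2 y
    ⟨frontier_subset_closure hy.1, fun e => hne e.symm⟩ hxy
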